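/- **Theorem 4.4.** For an integer $N\ge 1$ let $\epsilon=1/N$ and $\Lambda_N=[-N,N]\cap\mathbb Z$. Let $(\Omega,\mathbf P_\epsilon)$ carry the active/passive marks process: to the pairs $\{x,x+1\}$, $x\in\mathbb Z$, are attached mutually independent Poisson point processes on $[0,\infty)$ of intensity $\epsilon^{-2}$; their points are called marks, and each mark is independently declared active or passive with probability $\tfrac12$ each. A particle in $\Lambda_N$ moves as follows: as soon as an active mark appears at a pair $\{x,y\}$, where $x$ is the position of the particle and $y\in\Lambda_N$ is a neighbour of $x$, the particle moves to $y$ (a particle at $y$ then simultaneously moves to $x$). Passive marks, and marks at pairs not contained in $\Lambda_N$, do not move particles. For $x_1,x_2\in\Lambda_N$ let $x_1(s),x_2(s)$ be the (right-continuous) positions at time $s$ of the particles that start at time $0$ from $x_1,x_2$, all particles being driven by the same marks. Let $\tau_{x_1,x_2}\in[0,\infty]$ be the smallest time $s\ge 0$ such that $|x_1(s)-x_2(s)|=1$ and at time $s$ a mark (active or passive) appears at the pair $\{x_1(s),x_2(s)\}$, with $\tau_{x_1,x_2}=\infty$ if there is none, and let $N_{x_1,x_2,t}$ be the number of such times $s$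 in $[0,t]$. 1. There is a constant $c$ such that for all $N\ge1$, with $\epsilon=1/N$, and all $t\ge 0$, $$\sup_{x_1,x_2\in\Lambda_N:\ |x_1-x_2|=1}\mathbf P_\epsilon\big[\tau_{x_1,x_2}\ge t\big]\le\frac{c}{(\epsilon^{-2}t)^{1/2}+1}.$$ 2. For every $T>0$, every $\zeta>0$ and every real $k\ge 1$ there is a constant $c$ such that for all $t\in(0,T]$ and all $N\ge 1$, with $\epsilon=1/N$, $$\sup_{x_1,x_2\in\Lambda_N}\mathbf P_\epsilon\big[N_{x_1,x_2,t}\ge(\epsilon^{-2}t)^{1/2+\zeta}\big]\le c\,(\epsilon^{-2}t)^{-k}.$$ -/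

import Mathlib

open MeasureTheory ProbabilityTheory

noncomputable section

namespace Stirring

/-- A realization of the marks. The integer `b` stands for the pair of sites `{b, b + 1}`;
`(ω b n).1` is the waiting time of the `n`-th mark at that pair after the previous one
(after time `0` if `n = 0`), and `(ω b n).2` is its attribute, `true` for active and
`false` for passive. -/
abbrev Marks : Type := ℤ → ℕ → ℝ × Bool

/-- Law of one waiting time together with the attribute of the mark that ends it: an exponential
time of rate `ε⁻²` and, independently, a fair attribute. -/
def markLaw (ε : ℝ) : Measure (ℝ × Bool) :=
  (expMeasure (ε⁻¹ ^ 2)).prod (PMF.uniformOfFintype Bool).toMeasure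

theorem isProbabilityMeasure_markLaw {ε : ℝ} (hε : 0 < ε) :
    IsProbabilityMeasure (markLaw ε) := by
  have : IsProbabilityMeasure (expMeasure (ε⁻¹ ^ 2)) :=
    isProbabilityMeasure_expMeasure (by positivity)
  unfold markLaw
  infer_instance

/-- The law of the active/passive marks process: independent Poisson processes of
intensity `ε⁻²` on `[0, ∞)`, one for each pair `{b, b + 1}` with `b ∈ ℤ` (independent exponential
waiting times), whose points carry independent fair attributes. -/
def marksLaw (ε : ℝ) : Measure Marks :=
  Measure.infinitePi fun _ : ℤ => Measure.infinitePi fun _ : ℕ => markLaw ε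

theorem isProbabilityMeasure_marksLaw {ε : ℝ} (hε : 0 < ε) :
    IsProbabilityMeasure (marksLaw ε) := by
  have := isProbabilityMeasure_markLaw hε
  unfold marksLaw
  infer_instance

/-- The time of the `n`-th mark at the pair `{b, b + 1}`. -/
def markTime (ω : Marks) (b : ℤ) (n : ℕ) : ℝ := ∑ i ∈ Finset.range (n + 1), (ω b i).1

/-- A mark, active or passive, appears at time `s` at the pair `{b, b + 1}`. -/
def IsMark (ω : Marks) (b : ℤ) (s : ℝ) : Prop := ∃ n, markTime ω b n = s

/-- An active mark appears at time `s` at the pair `{b, b + 1}`. -/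
def IsActiveMark (ω : Marks) (b : ℤ) (s : ℝ) : Prop :=
  ∃ n, markTime ω b n = s ∧ (ω b n).2 = true

/-- The interval `Λ_N = [-N, N]` of `ℤ`. -/
def box (N : ℕ) : Finset ℤ := Finset.Icc (-(N : ℤ)) N

/-- The integers `b` for which both sites of the pair `{b, b + 1}` are in `Λ_N`. -/
def bonds (N : ℕ) : Finset ℤ := (box N).filter fun b => b + 1 ∈ box N

/-- The times of the marks at the pairs contained in `Λ_N`. -/
def markTimes (N : ℕ) (ω : Marks) : Set ℝ := {s | ∃ b ∈ bonds N, IsMark ω b s}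

/-- `epoch N ω n` is the `n`-th positive time at which a mark appears in `Λ_N`, with
`epoch N ω 0 = 0`. Almost surely the mark times have no accumulation point, so that the
infimum is a minimum. -/
def epoch (N : ℕ) (ω : Marks) : ℕ → ℝ
  | 0 => 0
  | n + 1 => sInf {s | s ∈ markTimes N ω ∧ epoch N ω n < s}

open Classical in
/-- Effect of the marks at time `s` on a particle at `x`: it moves to the neighbour `y ∈ Λ_N` if
there is an active mark at the pair `{x, y}`. -/
def move (N : ℕ) (ω : Marks) (s : ℝ) (x : ℤ) : ℤ :=
  if x ∈ bonds N ∧ IsActiveMark ω x s then x + 1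
  else if x - 1 ∈ bonds N ∧ IsActiveMark ω (x - 1) s then x - 1
  else x

/-- The position, just after the `n`-th epoch, of the particle that starts from `x`. -/
def skeleton (N : ℕ) (ω : Marks) (x : ℤ) : ℕ → ℤ
  | 0 => x
  | n + 1 => move N ω (epoch N ω (n + 1)) (skeleton N ω x n)

/-- The position at time `t` of the particle that starts from `x`; the path is constant between
mark times and right continuous. -/
def position (N : ℕ) (ω : Marks) (x : ℤ) (t : ℝ) : ℤ :=
  skeleton N ω x (Set.ncard {s | s ∈ markTimes N ω ∧ 0 < s ∧ s ≤ t})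

/-- The set of the times `s ≥ 0` at which the particles that start from `x₁`, `x₂` are at
distance `1`. -/
def contactTimes (N : ℕ) (x₁ x₂ : ℤ) (ω : Marks) : Set ℝ :=
  {s | 0 ≤ s ∧ |position N ω x₁ s - position N ω x₂ s| = 1}

/-- The triples `(s, y₁, y₂)` with `s` a contact time, `yᵢ` the positions of the two particles at
time `s`, such that at time `s` a mark, active or passive, appears between `y₁` and `y₂`. -/
def contactMarks (N : ℕ) (x₁ x₂ : ℤ) (ω : Marks) : Set (ℝ × ℤ × ℤ) :=
  {p | p.1 ∈ contactTimes N x₁ x₂ ω ∧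
    p.2.1 = position N ω x₁ p.1 ∧ p.2.2 = position N ω x₂ p.1 ∧
    IsMark ω (min p.2.1 p.2.2) p.1}

/-- The first time of a mark between the two particles, `⊤` if there is none. -/
def tau (N : ℕ) (x₁ x₂ : ℤ) (ω : Marks) : EReal :=
  ⨅ p ∈ contactMarks N x₁ x₂ ω, (p.1 : EReal)

/-- The number of marks between the two particles in the time interval `[0, t]`. -/
def numMarks (N : ℕ) (x₁ x₂ : ℤ) (t : ℝ) (ω : Marks) : ℕ∞ :=
  Set.encard {p | p ∈ contactMarks N x₁ x₂ ω ∧ p.1 ≤ t}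

end Stirring

end

/-!
The marks process regenerates at the first mark in `Λ_N`: it is exponential, uniformly distributed
over the pairs, and what follows it is again a marks process. So two particles form a
continuous-time Markov chain, and a nonnegative supersolution of its backward equation which is at
least `1` on a set `F` bounds the probability of being in `F` at time `s`.

For `τ`, write `s = ε⁻² t` and `M ≈ √s`. Before their first contact mark, the distance `d ≥ 1` of
the particles behaves like a random walk which is only pushed inwards by the ends of `Λ_N`. It
reaches `M` before a contact mark with probability at most `d / M`, and it leaves `(0, M)` after a
mean time of order `d (M - d)`; with `d = 1` both errors are of order `1 / √s`.

For `N_t`, let `1 ≤ M ≤ N` be of order `√s`. The supersolution is an exponential moment of the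
number of contact marks: a parabola in the distance up to scale `M` makes it possible for each
contact mark to count with a factor `1 + 1 / (4 M)`, and parabolas in the distances to the ends of
`Λ_N` compensate for the drift there, at the price of a growth rate of order `M⁻²` in `s`. Hence
`P[N_t ≥ j]` decays like `exp (-c j / √s)`, which for `j = s ^ (1 / 2 + ζ)` beats every power of
`s`.
-/

noncomputable section

namespace Stirring

open scoped ENNReal
open Measure
open Function (update)

section Product

variable {ι : Type*} [DecidableEq ι] {X : ι → Type*} [∀ i, MeasurableSpace (X i)]
  (μ : (i : ι) → Measure (X i)) [∀ i, IsProbabilityMeasure (μ i)]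

theorem measurePreserving_update_infinitePi (i : ι) :
    MeasurePreserving (fun p : (Π j, X j) × X i => update p.1 i p.2)
      ((infinitePi μ).prod (μ i)) (infinitePi μ) := by
  refine ⟨measurable_update', eq_infinitePi _ fun s t ht => ?_⟩
  have hpre : (fun p : (Π j, X j) × X i => update p.1 i p.2) ⁻¹' (Set.pi s t) =
      (Set.pi (s.erase i) t) ×ˢ (if i ∈ s then t i else Set.univ) := by
    ext ⟨ω, x⟩
    simp only [Set.mem_preimage, Set.mem_pi, Set.mem_prod, Finset.mem_coe, Finset.mem_erase]
    refine ⟨fun h => ⟨fun j hj => by simpa [hj.1] using h j hj.2, ?_⟩, fun h j hj => ?_⟩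
    · split_ifs with hi
      · simpa using h i hi
      · trivial
    · by_cases hji : j = i
      · subst hji; simpa [hj] using h.2
      · simpa [hji] using h.1 j ⟨hji, hj⟩
  rw [map_apply measurable_update' (.pi s.countable_toSet fun j _ => ht j), hpre, prod_prod,
    infinitePi_pi _ fun j _ => ht j]
  split_ifs with hi
  · exact Finset.prod_erase_mul s (fun j => μ j (t j)) hi
  · simp [Finset.erase_eq_of_notMem hi]

variable {μ} {i : ι}

theorem measurePreserving_update_comp_infinitePi {E : Type*} [MeasurableSpace E]
    {ν : Measure E} [SFinite ν] {g : X i × E → X i}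
    (hg : MeasurePreserving g ((μ i).prod ν) (μ i)) :
    MeasurePreserving (fun p : (Π j, X j) × E => update p.1 i (g (p.1 i, p.2)))
      ((infinitePi μ).prod ν) (infinitePi μ) := by
  have hgm := hg.measurable
  have hm : Measurable fun p : (Π j, X j) × E => update p.1 i (g (p.1 i, p.2)) :=
    measurable_update'.comp
      (by fun_prop : Measurable fun p : (Π j, X j) × E => (p.1, g (p.1 i, p.2)))
  have hupd := measurePreserving_update_infinitePi μ i
  have hresample := hupd.prod (MeasurePreserving.id ν)
  have hcomp := hupd.comp (((MeasurePreserving.id (infinitePi μ)).prod hg).comp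
    (measurePreserving_prodAssoc (infinitePi μ) (μ i) ν))
  rw [← hresample.map_eq]
  refine .map_of_comp ?_ hm hresample.measurable
  convert hcomp using 1
  ext1 p
  simp [MeasurableEquiv.prodAssoc]

theorem infinitePi_inter_preimage_update {E : Set (X i)} (hE : MeasurableSet E) {f : X i → X i}
    (hf : Measurable f) {c : ℝ≥0∞}
    (h : ∀ A, MeasurableSet A → μ i (E ∩ f ⁻¹' A) = c * μ i A)
    {A : Set (Π i, X i)} (hA : MeasurableSet A) :
    infinitePi μ ({ω | ω i ∈ E} ∩ (fun ω => update ω i (f (ω i))) ⁻¹' A) =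
      c * infinitePi μ A := by
  have hupd := measurePreserving_update_infinitePi μ i
  have hm : MeasurableSet ({ω | ω i ∈ E} ∩ (fun ω => update ω i (f (ω i))) ⁻¹' A) :=
    (measurable_pi_apply i hE).inter ((measurable_update'.comp
      (by fun_prop : Measurable fun ω : Π j, X j => (ω, f (ω i)))) hA)
  rw [← hupd.measure_preimage hm.nullMeasurableSet, ← hupd.measure_preimage hA.nullMeasurableSet,
    prod_apply (hupd.measurable hm), prod_apply (hupd.measurable hA),
    ← lintegral_const_mul _ (measurable_measure_prodMk_left (hupd.measurable hA))]
  refine lintegral_congr fun ω => ?_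
  rw [← h _ (measurable_prodMk_left (hupd.measurable hA))]
  congr 1
  ext x
  simp

end Product

/-- The sequence `e, q 0, q 1, …`. -/
def consSeq {E : Type*} (e : E) (q : ℕ → E) : ℕ → E
  | 0 => e
  | n + 1 => q n

section ConsSeq

variable {E : Type*}

@[simp] theorem consSeq_zero (e : E) (q : ℕ → E) : consSeq e q 0 = e := rfl

@[simp] theorem consSeq_succ (e : E) (q : ℕ → E) (n : ℕ) : consSeq e q (n + 1) = q n := rfl

variable [MeasurableSpace E]

theorem measurable_consSeq : Measurable (fun p : (ℕ → E) × E => consSeq p.2 p.1) := by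
  refine measurable_pi_lambda _ fun n => ?_
  cases n with
  | zero => exact measurable_snd
  | succ n => exact (measurable_pi_apply n).comp measurable_fst

theorem measurePreserving_consSeq (ν : Measure E) [IsProbabilityMeasure ν] :
    MeasurePreserving (fun p : (ℕ → E) × E => consSeq p.2 p.1)
      ((infinitePi fun _ : ℕ => ν).prod ν) (infinitePi fun _ : ℕ => ν) := by
  refine ⟨measurable_consSeq, eq_infinitePi _ fun s t ht => ?_⟩
  set s' : Finset ℕ := s.preimage Nat.succ Nat.succ_injective.injOn with hs'
  have hpre : (fun p : (ℕ → E) × E => consSeq p.2 p.1) ⁻¹' (Set.pi s t) =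
      (Set.pi s' fun n => t (n + 1)) ×ˢ (if 0 ∈ s then t 0 else Set.univ) := by
    ext ⟨q, e⟩
    simp only [Set.mem_preimage, Set.mem_pi, Set.mem_prod, Finset.mem_coe, hs', Finset.mem_preimage]
    refine ⟨fun h => ⟨fun n hn => h (n + 1) hn, ?_⟩, fun h n hn => ?_⟩
    · split_ifs with h0
      · exact h 0 h0
      · trivial
    · cases n with
      | zero => simpa [hn] using h.2
      | succ n => exact h.1 n hn
  have hprod : ∏ n ∈ s', ν (t (n + 1)) = ∏ n ∈ s.erase 0, ν (t n) := by
    refine Finset.prod_bij (fun n _ => n + 1) (fun n hn => by simpa [hs'] using hn)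
      (fun a _ b _ hab => by simpa using hab) (fun n hn => ?_) fun _ _ => rfl
    obtain ⟨hn0, hns⟩ := Finset.mem_erase.1 hn
    obtain ⟨k, rfl⟩ := Nat.exists_eq_succ_of_ne_zero hn0
    exact ⟨k, by simpa [hs'] using hns, rfl⟩
  rw [map_apply measurable_consSeq (.pi s.countable_toSet fun j _ => ht j), hpre, prod_prod,
    infinitePi_pi _ fun j _ => ht _, hprod]
  split_ifs with h0
  · exact Finset.prod_erase_mul s (fun n => ν (t n)) h0
  · simp [Finset.erase_eq_of_notMem h0]

end ConsSeq

section Exponential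

theorem expMeasure_eq_withDensity (r : ℝ) :
    expMeasure r = volume.withDensity (exponentialPDF r) := rfl

theorem measurable_exponentialPDF (r : ℝ) : Measurable (exponentialPDF r) :=
  (measurable_exponentialPDFReal r).ennreal_ofReal

theorem lintegral_expMeasure {r : ℝ} {f : ℝ → ℝ≥0∞} (hf : Measurable f) :
    ∫⁻ x, f x ∂(expMeasure r) =
      ∫⁻ x in Set.Ici 0, ENNReal.ofReal (r * Real.exp (-(r * x))) * f x := by
  rw [expMeasure_eq_withDensity, lintegral_withDensity_eq_lintegral_mul _
    (measurable_exponentialPDF r) hf, ← lintegral_indicator measurableSet_Ici]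
  congr 1
  ext x
  by_cases hx : 0 ≤ x
  · simp [hx, exponentialPDF_of_nonneg hx]
  · simp [hx, exponentialPDF_of_neg (not_le.1 hx)]

/-- Memorylessness of the exponential law. -/
theorem expMeasure_inter_preimage_sub {r s : ℝ} (hs : 0 ≤ s) {A : Set ℝ}
    (hA : MeasurableSet A) :
    expMeasure r (Set.Ioi s ∩ (fun x => x - s) ⁻¹' A) =
      ENNReal.ofReal (Real.exp (-(r * s))) * expMeasure r A := by
  have hm : MeasurableSet (Set.Ioi s ∩ (fun x => x - s) ⁻¹' A) :=
    measurableSet_Ioi.inter ((measurable_id.sub_const s) hA)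
  rw [expMeasure_eq_withDensity, withDensity_apply _ hm, withDensity_apply _ hA,
    ← lintegral_indicator hm, ← lintegral_indicator hA,
    ← lintegral_const_mul _ ((measurable_exponentialPDF r).indicator hA),
    ← lintegral_add_right_eq_self _ s]
  refine lintegral_congr_ae ?_
  filter_upwards [compl_mem_ae_iff.2 (measure_singleton (0 : ℝ))] with x hx
  rcases lt_or_gt_of_ne hx with hneg | hpos
  · simp [Set.indicator, not_lt.2 hneg.le, exponentialPDF_of_neg hneg]
  · have hpdf_add : exponentialPDF r (x + s) =
        ENNReal.ofReal (Real.exp (-(r * s))) * exponentialPDF r x := by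
      rw [exponentialPDF_of_nonneg (by linarith), exponentialPDF_of_nonneg hpos.le,
        ← ENNReal.ofReal_mul (Real.exp_nonneg _), mul_left_comm, ← Real.exp_add]
      ring_nf
    by_cases hxA : x ∈ A <;> simp [hpos, hxA, hpdf_add]

theorem expMeasure_Ioi {r s : ℝ} (hr : 0 < r) (hs : 0 ≤ s) :
    expMeasure r (Set.Ioi s) = ENNReal.ofReal (Real.exp (-(r * s))) := by
  have := isProbabilityMeasure_expMeasure hr
  simpa using expMeasure_inter_preimage_sub (r := r) hs MeasurableSet.univ

instance nullSingletonClass_expMeasure (r : ℝ) : NullSingletonClass (expMeasure r) := by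
  rw [expMeasure_eq_withDensity]; infer_instance

theorem expMeasure_Ici {r s : ℝ} (hr : 0 < r) (hs : 0 ≤ s) :
    expMeasure r (Set.Ici s) = ENNReal.ofReal (Real.exp (-(r * s))) := by
  rw [← expMeasure_Ioi hr hs]
  exact measure_congr Ioi_ae_eq_Ici.symm

end Exponential

section Regeneration

variable {ε : ℝ}

theorem isProbabilityMeasure_waitLaw (hε : 0 < ε) :
    IsProbabilityMeasure (expMeasure (ε⁻¹ ^ 2)) :=
  isProbabilityMeasure_expMeasure (by positivity)

theorem lintegral_markLaw (hε : 0 < ε) {f : ℝ × Bool → ℝ≥0∞} (hf : Measurable f) :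
    ∫⁻ e, f e ∂(markLaw ε) =
      ∫⁻ s in Set.Ici 0, ENNReal.ofReal (ε⁻¹ ^ 2 * Real.exp (-(ε⁻¹ ^ 2 * s))) *
        (2⁻¹ * ∑ a : Bool, f (s, a)) := by
  have := isProbabilityMeasure_waitLaw hε
  rw [markLaw, lintegral_prod _ hf.aemeasurable, lintegral_expMeasure hf.lintegral_prod_right']
  simp [lintegral_fintype, mul_add, mul_comm]

theorem markLaw_inter_preimage_sub (hε : 0 < ε) {s : ℝ} (hs : 0 ≤ s) {A : Set (ℝ × Bool)}
    (hA : MeasurableSet A) :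
    markLaw ε ({e | s < e.1} ∩ (fun e => (e.1 - s, e.2)) ⁻¹' A) =
      ENNReal.ofReal (Real.exp (-(ε⁻¹ ^ 2 * s))) * markLaw ε A := by
  have := isProbabilityMeasure_waitLaw hε
  have hm : MeasurableSet ({e : ℝ × Bool | s < e.1} ∩ (fun e => (e.1 - s, e.2)) ⁻¹' A) :=
    (measurableSet_lt measurable_const measurable_fst).inter
      ((by fun_prop : Measurable fun e : ℝ × Bool => (e.1 - s, e.2)) hA)
  rw [markLaw, prod_apply_symm hm, prod_apply_symm hA,
    ← lintegral_const_mul _ (measurable_measure_prodMk_right hA)]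
  refine lintegral_congr fun a => ?_
  rw [← expMeasure_inter_preimage_sub hs (measurable_prodMk_right hA)]
  rfl

/-- The law of the sequence of marks at one pair of sites. -/
def seqLaw (ε : ℝ) : Measure (ℕ → ℝ × Bool) := infinitePi fun _ : ℕ => markLaw ε

theorem isProbabilityMeasure_seqLaw (hε : 0 < ε) : IsProbabilityMeasure (seqLaw ε) := by
  have := isProbabilityMeasure_markLaw hε
  unfold seqLaw
  infer_instance

/-- The sequence of marks at one pair of sites as seen from the time `s`, provided that no mark has
appeared by then. -/
def shiftHead (s : ℝ) (q : ℕ → ℝ × Bool) : ℕ → ℝ × Bool :=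
  update q 0 ((q 0).1 - s, (q 0).2)

theorem measurable_shiftHead_prod :
    Measurable (fun p : ℝ × (ℕ → ℝ × Bool) => shiftHead p.1 p.2) :=
  measurable_update'.comp (by fun_prop : Measurable fun p : ℝ × (ℕ → ℝ × Bool) =>
    (p.2, ((p.2 0).1 - p.1, (p.2 0).2)))

theorem seqLaw_inter_preimage_shiftHead (hε : 0 < ε) {s : ℝ} (hs : 0 ≤ s)
    {A : Set (ℕ → ℝ × Bool)} (hA : MeasurableSet A) :
    seqLaw ε ({q | s < (q 0).1} ∩ shiftHead s ⁻¹' A) =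
      ENNReal.ofReal (Real.exp (-(ε⁻¹ ^ 2 * s))) * seqLaw ε A := by
  have := isProbabilityMeasure_markLaw hε
  exact infinitePi_inter_preimage_update (μ := fun _ : ℕ => markLaw ε) (E := {e | s < e.1})
    (measurableSet_lt measurable_const measurable_fst) (f := fun e => (e.1 - s, e.2))
    (by fun_prop) (fun _ hA => markLaw_inter_preimage_sub hε hs hA) hA

/-- The marks as seen at the pairs in `J` from the time `s`, provided that no mark has appeared
there by then. -/
def elapse (J : Finset ℤ) (s : ℝ) (ω : Marks) : Marks :=
  J.piecewise (fun c => shiftHead s (ω c)) ω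

theorem elapse_of_mem {J : Finset ℤ} {c : ℤ} (hc : c ∈ J) (s : ℝ) (ω : Marks) :
    elapse J s ω c = shiftHead s (ω c) := by simp [elapse, hc]

theorem elapse_of_notMem {J : Finset ℤ} {c : ℤ} (hc : c ∉ J) (s : ℝ) (ω : Marks) :
    elapse J s ω c = ω c := by simp [elapse, hc]

theorem elapse_empty (s : ℝ) : elapse ∅ s = id := by ext1 ω; simp [elapse]

theorem elapse_insert {J : Finset ℤ} {b : ℤ} (hb : b ∉ J) (s : ℝ) (ω : Marks) :
    elapse (insert b J) s ω = update (elapse J s ω) b (shiftHead s (elapse J s ω b)) := by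
  rw [elapse_of_notMem hb, elapse, Finset.piecewise_insert, elapse]

theorem measurable_elapse_prod (J : Finset ℤ) :
    Measurable (fun p : ℝ × Marks => elapse J p.1 p.2) := by
  refine measurable_pi_lambda _ fun c => ?_
  by_cases hc : c ∈ J
  · simp only [elapse_of_mem hc]
    exact measurable_shiftHead_prod.comp
      (by fun_prop : Measurable fun p : ℝ × Marks => (p.1, p.2 c))
  · simp only [elapse_of_notMem hc]
    fun_prop

/-- Memorylessness of the marks process. -/
theorem marksLaw_inter_preimage_elapse (hε : 0 < ε) (J : Finset ℤ) {s : ℝ} (hs : 0 ≤ s)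
    {A : Set Marks} (hA : MeasurableSet A) :
    marksLaw ε ({ω | ∀ c ∈ J, s < (ω c 0).1} ∩ elapse J s ⁻¹' A) =
      ENNReal.ofReal (Real.exp (-(ε⁻¹ ^ 2 * s))) ^ J.card * marksLaw ε A := by
  have := isProbabilityMeasure_seqLaw hε
  induction J using Finset.induction_on generalizing A with
  | empty => simp [elapse_empty]
  | insert b J hb ih =>
    have hE : MeasurableSet {q : ℕ → ℝ × Bool | s < (q 0).1} :=
      measurableSet_lt measurable_const (by fun_prop)
    have hshift : Measurable (shiftHead s) := measurable_shiftHead_prod.of_uncurry_left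
    have hm : MeasurableSet ({ω : Marks | s < (ω b 0).1} ∩
        (fun ω => update ω b (shiftHead s (ω b))) ⁻¹' A) :=
      (hE.preimage (measurable_pi_apply b)).inter ((measurable_update'.comp
        (by fun_prop : Measurable fun ω : Marks => (ω, shiftHead s (ω b)))) hA)
    have hsplit : {ω : Marks | ∀ c ∈ insert b J, s < (ω c 0).1} ∩ elapse (insert b J) s ⁻¹' A =
        {ω | ∀ c ∈ J, s < (ω c 0).1} ∩ elapse J s ⁻¹' ({ω | s < (ω b 0).1} ∩
          (fun ω => update ω b (shiftHead s (ω b))) ⁻¹' A) := by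
      ext ω
      simp only [Set.mem_inter_iff, Set.mem_preimage, Set.mem_ofPred_eq, Finset.forall_mem_insert,
        elapse_insert hb, elapse_of_notMem hb]
      tauto
    rw [hsplit, ih hm, Finset.card_insert_of_notMem hb, pow_succ _ J.card, mul_assoc]
    congr 1
    exact infinitePi_inter_preimage_update (μ := fun _ : ℤ => seqLaw ε) (i := b) hE hshift
      (fun _ hA => seqLaw_inter_preimage_shiftHead hε hs hA) hA

/-- The marks `ω` preceded at the pair `b` by the mark `e`; the waiting time of the mark formerly
first is counted from `e`. -/
def insertMark (b : ℤ) (e : ℝ × Bool) (ω : Marks) : Marks :=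
  update ω b (consSeq e (ω b))

@[simp] theorem insertMark_self_zero (b : ℤ) (e : ℝ × Bool) (ω : Marks) :
    insertMark b e ω b 0 = e := by simp [insertMark]

@[simp] theorem insertMark_self_succ (b : ℤ) (e : ℝ × Bool) (ω : Marks) (n : ℕ) :
    insertMark b e ω b (n + 1) = ω b n := by simp [insertMark]

theorem insertMark_of_ne {b c : ℤ} (h : c ≠ b) (e : ℝ × Bool) (ω : Marks) :
    insertMark b e ω c = ω c := by simp [insertMark, h]

theorem measurePreserving_insertMark (hε : 0 < ε) (b : ℤ) :
    MeasurePreserving (fun p : Marks × (ℝ × Bool) => insertMark b p.2 p.1)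
      ((marksLaw ε).prod (markLaw ε)) (marksLaw ε) := by
  have := isProbabilityMeasure_markLaw hε
  have := isProbabilityMeasure_seqLaw hε
  exact measurePreserving_update_comp_infinitePi (μ := fun _ : ℤ => seqLaw ε)
    (measurePreserving_consSeq (markLaw ε))

/-- The marks as seen at the pairs in `B` from the time of the first mark there, provided that this
mark is at the pair `b`. -/
def afterFirst (B : Finset ℤ) (b : ℤ) (ω : Marks) : Marks :=
  elapse (B.erase b) (ω b 0).1 (update ω b fun n => ω b (n + 1))

theorem afterFirst_insertMark (B : Finset ℤ) (b : ℤ) (e : ℝ × Bool) (ω : Marks) :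
    afterFirst B b (insertMark b e ω) = elapse (B.erase b) e.1 ω := by
  simp [afterFirst, insertMark]

theorem measurable_afterFirst (B : Finset ℤ) (b : ℤ) : Measurable (afterFirst B b) :=
  (measurable_elapse_prod (B.erase b)).comp <| (by fun_prop : Measurable fun ω : Marks =>
    (ω b 0).1).prodMk <| measurable_update'.comp
      (by fun_prop : Measurable fun ω : Marks => (ω, fun n => ω b (n + 1)))

/-- The first mark in `B` is at the pair `b`. -/
def IsFirst (B : Finset ℤ) (b : ℤ) (ω : Marks) : Prop :=
  ∀ c ∈ B.erase b, (ω b 0).1 < (ω c 0).1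

theorem isFirst_insertMark {B : Finset ℤ} {b : ℤ} {e : ℝ × Bool} {ω : Marks} :
    IsFirst B b (insertMark b e ω) ↔ ∀ c ∈ B.erase b, e.1 < (ω c 0).1 := by
  simp only [IsFirst, insertMark_self_zero]
  refine forall₂_congr fun c hc => ?_
  rw [insertMark_of_ne (Finset.ne_of_mem_erase hc)]

theorem measurableSet_isFirst (B : Finset ℤ) (b : ℤ) : MeasurableSet {ω | IsFirst B b ω} := by
  simp only [IsFirst, Set.ofPred_forall]
  exact Finset.measurableSet_biInter _ fun c _ => measurableSet_lt (by fun_prop) (by fun_prop)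

/-- Regeneration of the marks process at the time of the first mark. -/
theorem marksLaw_first_mark (hε : 0 < ε) {B : Finset ℤ} {b : ℤ} (hb : b ∈ B)
    {A : Set ((ℝ × Bool) × Marks)} (hA : MeasurableSet A) :
    marksLaw ε {ω | IsFirst B b ω ∧ (ω b 0, afterFirst B b ω) ∈ A} =
      ∫⁻ s in Set.Ici 0, ENNReal.ofReal (ε⁻¹ ^ 2 * Real.exp (-(ε⁻¹ ^ 2 * B.card * s))) *
        (2⁻¹ * ∑ a : Bool, marksLaw ε {ω | ((s, a), ω) ∈ A}) := by
  have := isProbabilityMeasure_markLaw hε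
  have := isProbabilityMeasure_marksLaw hε
  have hins := measurePreserving_insertMark hε b
  have hW : MeasurableSet {ω | IsFirst B b ω ∧ (ω b 0, afterFirst B b ω) ∈ A} :=
    (measurableSet_isFirst B b).inter
      ((by fun_prop : Measurable fun ω : Marks => ω b 0).prodMk (measurable_afterFirst B b) hA)
  have hslice : ∀ s ∈ Set.Ici (0 : ℝ), ∀ a, marksLaw ε {ω | IsFirst B b (insertMark b (s, a) ω) ∧
      (insertMark b (s, a) ω b 0, afterFirst B b (insertMark b (s, a) ω)) ∈ A} =
      ENNReal.ofReal (Real.exp (-(ε⁻¹ ^ 2 * s))) ^ (B.erase b).card *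
        marksLaw ε {ω | ((s, a), ω) ∈ A} := fun s hs a => by
    simp only [isFirst_insertMark, insertMark_self_zero, afterFirst_insertMark]
    exact marksLaw_inter_preimage_elapse hε (B.erase b) hs (measurable_prodMk_left hA)
  have hexp : ∀ s, ENNReal.ofReal (ε⁻¹ ^ 2 * Real.exp (-(ε⁻¹ ^ 2 * s))) *
      ENNReal.ofReal (Real.exp (-(ε⁻¹ ^ 2 * s))) ^ (B.erase b).card =
      ENNReal.ofReal (ε⁻¹ ^ 2 * Real.exp (-(ε⁻¹ ^ 2 * B.card * s))) := fun s => by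
    rw [← ENNReal.ofReal_pow (Real.exp_nonneg _), ← ENNReal.ofReal_mul (by positivity), mul_assoc,
      ← pow_succ', Finset.card_erase_add_one hb, ← Real.exp_nat_mul]
    ring_nf
  rw [← hins.measure_preimage hW.nullMeasurableSet, prod_apply_symm (hins.measurable hW),
    lintegral_markLaw hε (measurable_measure_prodMk_right (hins.measurable hW))]
  refine setLIntegral_congr_fun measurableSet_Ici fun s hs => ?_
  simp only [Set.preimage_ofPred_eq, hslice s hs]
  rw [← Finset.mul_sum, ← hexp]
  ring

theorem seqLaw_head_ge (hε : 0 < ε) {t : ℝ} (ht : 0 ≤ t) :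
    seqLaw ε {q | t ≤ (q 0).1} = ENNReal.ofReal (Real.exp (-(ε⁻¹ ^ 2 * t))) := by
  have := isProbabilityMeasure_markLaw hε
  have := isProbabilityMeasure_waitLaw hε
  have hmark : markLaw ε {e | t ≤ e.1} = ENNReal.ofReal (Real.exp (-(ε⁻¹ ^ 2 * t))) := by
    have hset : {e : ℝ × Bool | t ≤ e.1} = Set.Ici t ×ˢ Set.univ := by ext; simp
    rw [markLaw, hset, prod_prod, expMeasure_Ici (by positivity) ht, measure_univ, mul_one]
  rw [← hmark]
  exact (measurePreserving_eval_infinitePi (fun _ : ℕ => markLaw ε) 0).measure_preimage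
    (measurableSet_le measurable_const measurable_fst).nullMeasurableSet

theorem marksLaw_forall_le (hε : 0 < ε) (B : Finset ℤ) {t : ℝ} (ht : 0 ≤ t) :
    marksLaw ε {ω | ∀ b ∈ B, t ≤ (ω b 0).1} =
      ENNReal.ofReal (Real.exp (-(ε⁻¹ ^ 2 * B.card * t))) := by
  have := isProbabilityMeasure_seqLaw hε
  have hpi : marksLaw ε (Set.pi B fun _ => {q | t ≤ (q 0).1}) =
      ∏ _b ∈ B, seqLaw ε {q | t ≤ (q 0).1} :=
    infinitePi_pi (fun _ : ℤ => seqLaw ε) fun _ _ =>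
      measurableSet_le measurable_const (by fun_prop)
  rw [Finset.prod_const, seqLaw_head_ge hε ht, ← ENNReal.ofReal_pow (Real.exp_nonneg _),
    ← Real.exp_nat_mul] at hpi
  convert hpi using 3
  · ext; simp
  · ring

end Regeneration

section Duhamel

theorem exp_mul_add_integral_le {w w' g : ℝ → ℝ} {l t : ℝ} (ht : 0 ≤ t)
    (hw : ∀ s, HasDerivAt w (w' s) s) (hg : Continuous g)
    (hle : ∀ s ∈ Set.Icc 0 t, g s ≤ w' s + l * w s) :
    Real.exp (-(l * t)) * w 0 + ∫ s in (0 : ℝ)..t, Real.exp (-(l * s)) * g (t - s) ≤ w t := by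
  have hderiv : ∀ s, HasDerivAt (fun s => -(Real.exp (-(l * s)) * w (t - s)))
      (Real.exp (-(l * s)) * (w' (t - s) + l * w (t - s))) s := fun s => by
    have hexp : HasDerivAt (fun s : ℝ => Real.exp (-(l * s)))
        (Real.exp (-(l * s)) * -(l * 1)) s := ((hasDerivAt_id s).const_mul l).neg.exp
    have hsub : HasDerivAt (fun s => w (t - s)) (w' (t - s) * -1) s :=
      (hw (t - s)).comp s (by simpa using (hasDerivAt_id s).const_sub t)
    exact (hexp.mul hsub).neg.congr_deriv (by ring)
  have hbound := intervalIntegral.integral_le_sub_of_hasDeriv_right_of_le ht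
    (fun s _ => (hderiv s).continuousAt.continuousWithinAt)
    (fun s _ => (hderiv s).hasDerivWithinAt)
    (φ := fun s => Real.exp (-(l * s)) * g (t - s))
    (Continuous.integrableOn_Icc (by fun_prop))
    (fun s hs => mul_le_mul_of_nonneg_left
      (hle (t - s) ⟨by linarith [hs.2], by linarith [hs.1]⟩) (Real.exp_nonneg _))
  simp only [sub_self, mul_zero, neg_zero, Real.exp_zero, one_mul, sub_zero] at hbound
  linarith

theorem sum_lintegral_le_ofReal_integral {κ : Type*} {B : Finset κ} {r l t : ℝ} (hr : 0 ≤ r)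
    (ht : 0 ≤ t) {p : κ → Bool → ℝ → ℝ≥0∞} {v : κ → Bool → ℝ → ℝ}
    (hv : ∀ b ∈ B, ∀ a, Continuous (v b a)) (hv0 : ∀ b ∈ B, ∀ a, ∀ s ∈ Set.Icc 0 t, 0 ≤ v b a s)
    (hpv : ∀ b ∈ B, ∀ a, ∀ s ∈ Set.Icc 0 t, p b a s ≤ ENNReal.ofReal (v b a s)) :
    ∑ b ∈ B, ∫⁻ s in Set.Icc 0 t, ENNReal.ofReal (r * Real.exp (-(l * s))) *
        (2⁻¹ * ∑ a : Bool, p b a s) ≤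
      ENNReal.ofReal (∫ s in (0 : ℝ)..t,
        Real.exp (-(l * s)) * (r / 2 * ∑ b ∈ B, ∑ a : Bool, v b a s)) := by
  have hc : ∀ b ∈ B, Continuous fun s => r * Real.exp (-(l * s)) * (2⁻¹ * ∑ a : Bool, v b a s) :=
    fun b hb => by
      have := continuous_finsetSum Finset.univ fun a _ => hv b hb a
      fun_prop
  have h0 : ∀ b ∈ B, ∀ s ∈ Set.Icc 0 t,
      0 ≤ r * Real.exp (-(l * s)) * (2⁻¹ * ∑ a : Bool, v b a s) := fun b hb s hs =>
    mul_nonneg (by positivity)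
      (mul_nonneg (by positivity) (Finset.sum_nonneg fun a _ => hv0 b hb a s hs))
  have hswap : ∫ s in (0 : ℝ)..t, Real.exp (-(l * s)) * (r / 2 * ∑ b ∈ B, ∑ a : Bool, v b a s) =
      ∑ b ∈ B, ∫ s in Set.Icc 0 t, r * Real.exp (-(l * s)) * (2⁻¹ * ∑ a : Bool, v b a s) := by
    simp only [integral_Icc_eq_integral_Ioc, ← intervalIntegral.integral_of_le ht]
    rw [← intervalIntegral.integral_finsetSum fun b hb => (hc b hb).intervalIntegrable _ _]
    refine intervalIntegral.integral_congr fun s _ => ?_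
    simp only [← Finset.mul_sum]
    ring
  rw [hswap, ENNReal.ofReal_sum_of_nonneg fun b hb =>
    setIntegral_nonneg measurableSet_Icc (h0 b hb)]
  refine Finset.sum_le_sum fun b hb => ?_
  rw [ofReal_integral_eq_lintegral_ofReal (hc b hb).integrableOn_Icc
    ((ae_restrict_iff' measurableSet_Icc).2 (.of_forall (h0 b hb)))]
  refine setLIntegral_mono' measurableSet_Icc fun s hs => ?_
  rw [ENNReal.ofReal_mul (p := r * Real.exp (-(l * s))) (by positivity),
    ENNReal.ofReal_mul (p := 2⁻¹) (by positivity),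
    ENNReal.ofReal_sum_of_nonneg fun a _ => hv0 b hb a s hs, ENNReal.ofReal_inv_of_pos two_pos,
    ENNReal.ofReal_ofNat]
  gcongr with a
  exact hpv b hb a s hs

end Duhamel

section Comparison

variable {ι : Type*} (B : Finset ℤ) (F : Set ι) (step : ι → ℤ → Bool → ι)

/-- The event that the chain which starts from `i`, and moves from `j` to `step j b a` at a mark
with attribute `a` at the pair `b` of `B`, has made `n` steps by time `t` or is in `F` at time `t`.
Conditioning on the first mark gives the recursion. -/
def chainEvent : ℕ → ι → ℝ → Set Marks
  | 0, _, _ => Set.univ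
  | n + 1, i, t => {ω | (i ∈ F ∧ ∀ b ∈ B, t ≤ (ω b 0).1) ∨
      ∃ b ∈ B, IsFirst B b ω ∧ (ω b 0).1 ≤ t ∧
        afterFirst B b ω ∈ chainEvent n (step i b (ω b 0).2) (t - (ω b 0).1)}

theorem measurableSet_chainEvent (n : ℕ) (i : ι) :
    MeasurableSet {p : ℝ × Marks | p.2 ∈ chainEvent B F step n i p.1} := by
  induction n generalizing i with
  | zero => simp [chainEvent]
  | succ n ih =>
    have hsplit : {p : ℝ × Marks | p.2 ∈ chainEvent B F step (n + 1) i p.1} =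
        ({_p : ℝ × Marks | i ∈ F} ∩ ⋂ b ∈ B, {p | p.1 ≤ (p.2 b 0).1}) ∪
        ⋃ b ∈ B, ⋃ a : Bool, ({p | IsFirst B b p.2} ∩ {p | (p.2 b 0).1 ≤ p.1} ∩
          {p | (p.2 b 0).2 = a} ∩
          {p | afterFirst B b p.2 ∈ chainEvent B F step n (step i b a) (p.1 - (p.2 b 0).1)}) := by
      ext p
      simp only [chainEvent, Set.mem_ofPred_eq, Set.mem_union, Set.mem_inter_iff, Set.mem_iInter,
        Set.mem_iUnion, exists_prop, and_assoc]
      refine or_congr Iff.rfl (exists_congr fun b => and_congr_right fun _ => ?_)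
      simp
    rw [hsplit]
    refine .union (.inter (.const _) (Finset.measurableSet_biInter _ fun b _ =>
      measurableSet_le (by fun_prop) (by fun_prop)))
      (Finset.measurableSet_biUnion _ fun b _ => .iUnion fun a => ?_)
    refine (((measurable_snd (measurableSet_isFirst B b)).inter
      (measurableSet_le (by fun_prop) (by fun_prop))).inter ?_).inter ?_
    · exact (by fun_prop : Measurable fun p : ℝ × Marks => (p.2 b 0).2) (measurableSet_singleton a)
    · have := measurable_afterFirst B b
      exact (by fun_prop : Measurable fun p : ℝ × Marks =>
        (p.1 - (p.2 b 0).1, afterFirst B b p.2)) (ih (step i b a))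

variable {B F step} {ε : ℝ}

theorem marksLaw_chainEvent_succ_le (hε : 0 < ε) (n : ℕ) (i : ι) {t : ℝ} (ht : 0 ≤ t) :
    marksLaw ε (chainEvent B F step (n + 1) i t) ≤
      F.indicator 1 i * ENNReal.ofReal (Real.exp (-(ε⁻¹ ^ 2 * B.card * t))) +
      ∑ b ∈ B, ∫⁻ s in Set.Icc 0 t,
        ENNReal.ofReal (ε⁻¹ ^ 2 * Real.exp (-(ε⁻¹ ^ 2 * B.card * s))) *
          (2⁻¹ * ∑ a : Bool, marksLaw ε (chainEvent B F step n (step i b a) (t - s))) := by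
  let A : ℤ → Set ((ℝ × Bool) × Marks) := fun b =>
    {p | p.1.1 ≤ t ∧ p.2 ∈ chainEvent B F step n (step i b p.1.2) (t - p.1.1)}
  have hA : ∀ b, MeasurableSet (A b) := fun b => by
    have hsplit : A b = {p | p.1.1 ≤ t} ∩ ⋃ a : Bool, {p | p.1.2 = a} ∩
        {p | p.2 ∈ chainEvent B F step n (step i b a) (t - p.1.1)} := by
      ext p; simp [A]
    rw [hsplit]
    refine (measurableSet_le (by fun_prop) measurable_const).inter (.iUnion fun a => .inter ?_ ?_)
    · exact measurable_fst.snd (measurableSet_singleton a)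
    · exact (by fun_prop : Measurable fun p : (ℝ × Bool) × Marks => (t - p.1.1, p.2))
        (measurableSet_chainEvent B F step n (step i b a))
  have hsub : chainEvent B F step (n + 1) i t ⊆ {ω | i ∈ F ∧ ∀ b ∈ B, t ≤ (ω b 0).1} ∪
      ⋃ b ∈ B, {ω | IsFirst B b ω ∧ (ω b 0, afterFirst B b ω) ∈ A b} := by
    rintro ω (hstay | ⟨b, hb, hmove⟩)
    · exact .inl hstay
    · exact .inr (Set.mem_biUnion hb hmove)
  refine (measure_mono hsub).trans ((measure_union_le _ _).trans (add_le_add ?_ ?_))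
  · by_cases hi : i ∈ F
    · simp [hi, marksLaw_forall_le hε B ht]
    · simp [hi]
  · refine (measure_biUnion_finset_le _ _).trans (Finset.sum_le_sum fun b hb => ?_)
    rw [marksLaw_first_mark hε hb (hA b), ← lintegral_indicator measurableSet_Ici,
      ← lintegral_indicator measurableSet_Icc]
    refine lintegral_mono fun s => ?_
    by_cases hs : 0 ≤ s <;> by_cases hst : s ≤ t <;> simp [hs, hst, A]

variable (B F step ε) in
/-- Supersolutions of the backward equation of the chain of `chainEvent` on an invariant set `I` of
states: `u s i`, with time derivative `u' s i`, is for `s ∈ [0, T]` to dominate the probability of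
being in `F` at time `s` when starting from `i`. Each of the moves `step i b a` has rate
`ε⁻² / 2`. -/
structure IsSupersolution (I : Set ι) (T : ℝ) (u u' : ℝ → ι → ℝ) : Prop where
  step_mem : ∀ i ∈ I, ∀ b ∈ B, ∀ a, step i b a ∈ I
  hasDerivAt : ∀ i ∈ I, ∀ s, HasDerivAt (fun s => u s i) (u' s i) s
  nonneg : ∀ i ∈ I, ∀ s ∈ Set.Icc 0 T, 0 ≤ u s i
  one_le : ∀ i ∈ I, i ∈ F → 1 ≤ u 0 i
  generator_le : ∀ i ∈ I, ∀ s ∈ Set.Icc 0 T,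
    ε⁻¹ ^ 2 / 2 * ∑ b ∈ B, ∑ a : Bool, (u s (step i b a) - u s i) ≤ u' s i

namespace IsSupersolution

variable {I : Set ι} {T : ℝ} {u u' : ℝ → ι → ℝ}

theorem continuous (hu : IsSupersolution B F step ε I T u u') {i : ι} (hi : i ∈ I) :
    Continuous fun s => u s i :=
  continuous_iff_continuousAt.2 fun s => (hu.hasDerivAt i hi s).continuousAt

/-- The error term `(1 / 2) ^ n * exp (l * s)`, with `l` the rate of all the marks, is what an
`n`-fold iteration of the integrated inequality leaves of the trivial bound `1`. -/
theorem sum_step_le (hu : IsSupersolution B F step ε I T u u') {i : ι} (hi : i ∈ I) {s : ℝ}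
    (hs : s ∈ Set.Icc 0 T) (n : ℕ) {l : ℝ} (hl : l = ε⁻¹ ^ 2 * B.card) :
    ε⁻¹ ^ 2 / 2 * ∑ b ∈ B, ∑ a : Bool, (u s (step i b a) + (1 / 2) ^ n * Real.exp (l * s)) ≤
      (u' s i + (1 / 2) ^ (n + 1) * (Real.exp (l * s) * (l * 1))) +
        l * (u s i + (1 / 2) ^ (n + 1) * Real.exp (l * s)) := by
  have hgen := hu.generator_le i hi s hs
  simp only [Fintype.sum_bool, Finset.sum_add_distrib, Finset.sum_sub_distrib, Finset.sum_const,
    Finset.card_univ, Fintype.card_bool, Nat.cast_ofNat, nsmul_eq_mul,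
    pow_succ (1 / 2 : ℝ)] at hgen ⊢
  subst hl
  linarith

theorem exp_mul_add_integral_le (hu : IsSupersolution B F step ε I T u u') {i : ι} (hi : i ∈ I)
    {t : ℝ} (ht : t ∈ Set.Icc 0 T) (n : ℕ) {l : ℝ} (hl : l = ε⁻¹ ^ 2 * B.card) :
    Real.exp (-(l * t)) * u 0 i + ∫ s in (0 : ℝ)..t, Real.exp (-(l * s)) * (ε⁻¹ ^ 2 / 2 *
        ∑ b ∈ B, ∑ a : Bool, (u (t - s) (step i b a) + (1 / 2) ^ n * Real.exp (l * (t - s)))) ≤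
      u t i + (1 / 2) ^ (n + 1) * Real.exp (l * t) := by
  have hderiv : ∀ s, HasDerivAt (fun s => u s i + (1 / 2) ^ (n + 1) * Real.exp (l * s))
      (u' s i + (1 / 2) ^ (n + 1) * (Real.exp (l * s) * (l * 1))) s := fun s =>
    (hu.hasDerivAt i hi s).add (((hasDerivAt_id s).const_mul l).exp.const_mul _)
  have hcont : Continuous fun s => ε⁻¹ ^ 2 / 2 * ∑ b ∈ B, ∑ a : Bool,
      (u s (step i b a) + (1 / 2) ^ n * Real.exp (l * s)) :=
    continuous_const.mul <| continuous_finsetSum _ fun b hb => continuous_finsetSum _ fun a _ =>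
      (hu.continuous (hu.step_mem i hi b hb a)).add (by fun_prop)
  have hbound := Stirring.exp_mul_add_integral_le ht.1 hderiv hcont
    fun s hs => hu.sum_step_le hi ⟨hs.1, hs.2.trans ht.2⟩ n hl
  refine le_trans ?_ hbound
  gcongr
  exact le_add_of_nonneg_right (by positivity)

theorem marksLaw_chainEvent_le (hε : 0 < ε) (hu : IsSupersolution B F step ε I T u u') (n : ℕ)
    {i : ι} (hi : i ∈ I) {t : ℝ} (ht : t ∈ Set.Icc 0 T) :
    marksLaw ε (chainEvent B F step n i t) ≤
      ENNReal.ofReal (u t i + (1 / 2) ^ n * Real.exp (ε⁻¹ ^ 2 * B.card * t)) := by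
  have := isProbabilityMeasure_marksLaw hε
  obtain ⟨l, hl⟩ : ∃ l, l = ε⁻¹ ^ 2 * B.card := ⟨_, rfl⟩
  rw [← hl]
  induction n generalizing i t with
  | zero =>
    have hexp : 1 ≤ Real.exp (l * t) :=
      Real.one_le_exp (mul_nonneg (hl ▸ by positivity) ht.1)
    rw [pow_zero, one_mul]
    exact prob_le_one.trans (ENNReal.one_le_ofReal.2 (by linarith [hu.nonneg i hi t ht]))
  | succ n ih =>
    have hmem : ∀ s ∈ Set.Icc 0 t, t - s ∈ Set.Icc 0 T := fun s hs =>
      ⟨by linarith [hs.2], by linarith [hs.1, ht.2]⟩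
    have hstep0 : ∀ b ∈ B, ∀ a, ∀ s ∈ Set.Icc 0 t,
        0 ≤ u (t - s) (step i b a) + (1 / 2) ^ n * Real.exp (l * (t - s)) := fun b hb a s hs =>
      add_nonneg (hu.nonneg _ (hu.step_mem i hi b hb a) _ (hmem s hs)) (by positivity)
    have h0 : 0 ≤ u 0 i := hu.nonneg i hi 0 ⟨le_rfl, ht.1.trans ht.2⟩
    have hstay : F.indicator (1 : ι → ℝ≥0∞) i * ENNReal.ofReal (Real.exp (-(l * t))) ≤
        ENNReal.ofReal (Real.exp (-(l * t)) * u 0 i) := by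
      by_cases hiF : i ∈ F
      · simpa [hiF] using ENNReal.ofReal_le_ofReal
          (le_mul_of_one_le_right (Real.exp_nonneg _) (hu.one_le i hi hiF))
      · simp [hiF]
    have hmove := sum_lintegral_le_ofReal_integral (B := B) (r := ε⁻¹ ^ 2) (l := l) (by positivity)
      ht.1 (p := fun b a s => marksLaw ε (chainEvent B F step n (step i b a) (t - s)))
      (v := fun b a s => u (t - s) (step i b a) + (1 / 2) ^ n * Real.exp (l * (t - s)))
      (fun b hb a => ((hu.continuous (hu.step_mem i hi b hb a)).comp (by fun_prop)).add
        (by fun_prop)) hstep0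
      (fun b hb a s hs => ih (hu.step_mem i hi b hb a) (hmem s hs))
    refine (hl ▸ marksLaw_chainEvent_succ_le hε n i ht.1).trans
      ((add_le_add hstay hmove).trans ?_)
    rw [← ENNReal.ofReal_add (by positivity) (intervalIntegral.integral_nonneg ht.1 fun s hs =>
      mul_nonneg (Real.exp_nonneg _) (mul_nonneg (by positivity) (Finset.sum_nonneg fun b hb =>
        Finset.sum_nonneg fun a _ => hstep0 b hb a s hs)))]
    exact ENNReal.ofReal_le_ofReal (hu.exp_mul_add_integral_le hi ht n hl)

theorem marksLaw_real_le (hε : 0 < ε) (hu : IsSupersolution B F step ε I T u u') {i : ι}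
    (hi : i ∈ I) {t : ℝ} (ht : t ∈ Set.Icc 0 T) {A : Set Marks}
    (hA : ∀ᵐ ω ∂(marksLaw ε), ω ∈ A → ∀ n, ω ∈ chainEvent B F step n i t) :
    (marksLaw ε).real A ≤ u t i := by
  have hlim : Filter.Tendsto (fun n : ℕ =>
      u t i + (1 / 2) ^ n * Real.exp (ε⁻¹ ^ 2 * B.card * t)) Filter.atTop (nhds (u t i)) := by
    have hpow := tendsto_pow_atTop_nhds_zero_of_lt_one (r := (1 / 2 : ℝ)) (by norm_num)
      (by norm_num)
    have := (hpow.mul_const (Real.exp (ε⁻¹ ^ 2 * B.card * t))).const_add (u t i)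
    simpa only [zero_mul, add_zero] using this
  refine ge_of_tendsto hlim (.of_forall fun n => ?_)
  refine ENNReal.toReal_le_of_le_ofReal (add_nonneg (hu.nonneg i hi t ht) (by positivity)) ?_
  refine le_trans (measure_mono_ae ?_) (hu.marksLaw_chainEvent_le hε n hi ht)
  filter_upwards [hA] with ω hω h using hω h n

end IsSupersolution

end Comparison

section Paths

/-- The almost sure properties of the marks at the pairs in `B` that the dynamics relies on: the
waiting times are positive, the marks do not accumulate, and no two of them are simultaneous. -/
structure Regular (B : Finset ℤ) (ω : Marks) : Prop where
  pos : ∀ b ∈ B, ∀ n, 0 < (ω b n).1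
  unbounded : ∀ b ∈ B, ∀ K : ℝ, ∃ n, K < markTime ω b n
  ne : ∀ b ∈ B, ∀ c ∈ B, b ≠ c → ∀ m n, markTime ω b m ≠ markTime ω c n

theorem markTime_zero (ω : Marks) (b : ℤ) : markTime ω b 0 = (ω b 0).1 := by
  simp [markTime]

theorem markTime_succ (ω : Marks) (b : ℤ) (n : ℕ) :
    markTime ω b (n + 1) = markTime ω b n + (ω b (n + 1)).1 :=
  Finset.sum_range_succ _ _

section AfterFirst

variable {B : Finset ℤ} {b c : ℤ} {ω : Marks}

theorem afterFirst_self (B : Finset ℤ) (b : ℤ) (ω : Marks) (n : ℕ) :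
    afterFirst B b ω b n = ω b (n + 1) := by
  simp [afterFirst, elapse]

theorem afterFirst_zero_of_ne (ω : Marks) (hc : c ∈ B) (hcb : c ≠ b) :
    afterFirst B b ω c 0 = ((ω c 0).1 - (ω b 0).1, (ω c 0).2) := by
  simp [afterFirst, elapse, shiftHead, hc, hcb]

theorem afterFirst_succ_of_ne (ω : Marks) (hcb : c ≠ b) (n : ℕ) :
    afterFirst B b ω c (n + 1) = ω c (n + 1) := by
  by_cases hc : c ∈ B <;> simp [afterFirst, elapse, shiftHead, hcb, hc]

theorem afterFirst_snd_of_ne (ω : Marks) (hc : c ∈ B) (hcb : c ≠ b) (n : ℕ) :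
    (afterFirst B b ω c n).2 = (ω c n).2 := by
  cases n with
  | zero => rw [afterFirst_zero_of_ne ω hc hcb]
  | succ n => rw [afterFirst_succ_of_ne ω hcb]

theorem markTime_afterFirst_self (B : Finset ℤ) (b : ℤ) (ω : Marks) (n : ℕ) :
    markTime (afterFirst B b ω) b n = markTime ω b (n + 1) - (ω b 0).1 := by
  simp only [markTime, afterFirst_self]
  rw [Finset.sum_range_succ' (fun i => (ω b i).1) (n + 1), add_sub_cancel_right]

theorem markTime_afterFirst_of_ne (ω : Marks) (hc : c ∈ B) (hcb : c ≠ b) (n : ℕ) :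
    markTime (afterFirst B b ω) c n = markTime ω c n - (ω b 0).1 := by
  simp only [markTime, Finset.sum_range_succ' _ n, afterFirst_succ_of_ne ω hcb,
    afterFirst_zero_of_ne ω hc hcb]
  ring

theorem exists_markTime_afterFirst_eq (b : ℤ) (ω : Marks) (hc : c ∈ B) (n : ℕ) :
    ∃ m, markTime (afterFirst B b ω) c n = markTime ω c m - (ω b 0).1 := by
  rcases eq_or_ne c b with rfl | hcb
  · exact ⟨n + 1, markTime_afterFirst_self B c ω n⟩
  · exact ⟨n, markTime_afterFirst_of_ne ω hc hcb n⟩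

theorem exists_mark_afterFirst_iff (P : Bool → Prop) (hc : c ∈ B) {s : ℝ} (hs : 0 < s) :
    (∃ n, markTime (afterFirst B b ω) c n = s ∧ P (afterFirst B b ω c n).2) ↔
      ∃ n, markTime ω c n = (ω b 0).1 + s ∧ P (ω c n).2 := by
  rcases eq_or_ne c b with rfl | hcb
  · simp only [markTime_afterFirst_self, afterFirst_self, sub_eq_iff_eq_add']
    refine ⟨fun ⟨n, hn⟩ => ⟨n + 1, hn⟩, ?_⟩
    rintro ⟨_ | n, hn⟩
    · rw [markTime_zero] at hn
      linarith [hn.1]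
    · exact ⟨n, hn⟩
  · refine exists_congr fun n => ?_
    rw [afterFirst_snd_of_ne ω hc hcb, markTime_afterFirst_of_ne ω hc hcb, sub_eq_iff_eq_add']

theorem isMark_afterFirst_iff (hc : c ∈ B) {s : ℝ} (hs : 0 < s) :
    IsMark (afterFirst B b ω) c s ↔ IsMark ω c ((ω b 0).1 + s) := by
  simpa only [IsMark, and_true] using exists_mark_afterFirst_iff (fun _ => True) hc hs

theorem isActiveMark_afterFirst_iff (hc : c ∈ B) {s : ℝ} (hs : 0 < s) :
    IsActiveMark (afterFirst B b ω) c s ↔ IsActiveMark ω c ((ω b 0).1 + s) :=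
  exists_mark_afterFirst_iff (fun a => a = true) hc hs

theorem IsFirst.first_le_wait (hf : IsFirst B b ω) (hc : c ∈ B) : (ω b 0).1 ≤ (ω c 0).1 := by
  rcases eq_or_ne c b with rfl | hcb
  · exact le_rfl
  · exact (hf c (Finset.mem_erase.2 ⟨hcb, hc⟩)).le

namespace Regular

theorem strictMono (hω : Regular B ω) (hb : b ∈ B) : StrictMono (markTime ω b) :=
  strictMono_nat_of_lt_succ fun n => by
    rw [markTime_succ]
    exact lt_add_of_pos_right _ (hω.pos b hb (n + 1))

theorem markTime_pos (hω : Regular B ω) (hb : b ∈ B) (n : ℕ) : 0 < markTime ω b n :=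
  Finset.sum_pos (fun i _ => hω.pos b hb i) (by simp)

theorem exists_isFirst (hω : Regular B ω) (hB : B.Nonempty) : ∃ b ∈ B, IsFirst B b ω := by
  obtain ⟨b, hb, hmin⟩ := B.exists_min_image (fun b => (ω b 0).1) hB
  refine ⟨b, hb, fun c hc => ?_⟩
  obtain ⟨hcb, hcB⟩ := Finset.mem_erase.1 hc
  refine lt_of_le_of_ne (hmin c hcB) ?_
  simpa only [markTime_zero] using hω.ne b hb c hcB hcb.symm 0 0

theorem first_le_markTime (hω : Regular B ω) (hf : IsFirst B b ω) (hc : c ∈ B) (n : ℕ) :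
    (ω b 0).1 ≤ markTime ω c n := by
  refine (hf.first_le_wait hc).trans ?_
  rw [← markTime_zero]
  exact (hω.strictMono hc).monotone n.zero_le

theorem markTime_eq_first_iff (hω : Regular B ω) (hb : b ∈ B) (hc : c ∈ B) (n : ℕ) :
    markTime ω c n = (ω b 0).1 ↔ c = b ∧ n = 0 := by
  rw [← markTime_zero]
  refine ⟨fun h => ?_, by rintro ⟨rfl, rfl⟩; rfl⟩
  obtain rfl : c = b := by_contra fun hcb => hω.ne c hc b hb hcb n 0 h
  exact ⟨rfl, (hω.strictMono hc).injective h⟩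

theorem regular_afterFirst (hω : Regular B ω) (hf : IsFirst B b ω) :
    Regular B (afterFirst B b ω) where
  pos c hc n := by
    rcases eq_or_ne c b with rfl | hcb
    · rw [afterFirst_self]
      exact hω.pos c hc _
    · cases n with
      | zero =>
        rw [afterFirst_zero_of_ne ω hc hcb]
        exact sub_pos.2 (hf c (Finset.mem_erase.2 ⟨hcb, hc⟩))
      | succ n =>
        rw [afterFirst_succ_of_ne ω hcb]
        exact hω.pos c hc _
  unbounded c hc K := by
    obtain ⟨n, hn⟩ := hω.unbounded c hc (K + (ω b 0).1)
    refine ⟨n, ?_⟩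
    rcases eq_or_ne c b with rfl | hcb
    · rw [markTime_afterFirst_self, lt_sub_iff_add_lt]
      exact hn.trans (hω.strictMono hc n.lt_succ_self)
    · rwa [markTime_afterFirst_of_ne ω hc hcb, lt_sub_iff_add_lt]
  ne c hc d hd hcd m n := by
    obtain ⟨k, hk⟩ := exists_markTime_afterFirst_eq b ω hc m
    obtain ⟨l, hl⟩ := exists_markTime_afterFirst_eq b ω hd n
    rw [hk, hl, Ne, sub_left_inj]
    exact hω.ne c hc d hd hcd k l

end Regular

end AfterFirst

/-- Effect of a mark with attribute `a` at the pair `{b, b + 1}` on a particle at `x`. -/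
def exchange (b : ℤ) (a : Bool) (x : ℤ) : ℤ :=
  if a = true ∧ x = b then b + 1 else if a = true ∧ x = b + 1 then b else x

theorem exchange_false (b x : ℤ) : exchange b false x = x := by simp [exchange]

theorem exchange_true (b x : ℤ) :
    exchange b true x = if x = b then b + 1 else if x = b + 1 then b else x := by
  simp [exchange]

/-- The particles at `x` and `y` occupy the two sites of the pair `{b, b + 1}`. -/
def Touch (b x y : ℤ) : Prop := (x = b ∧ y = b + 1) ∨ (x = b + 1 ∧ y = b)

instance (b x y : ℤ) : Decidable (Touch b x y) := by unfold Touch; infer_instance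

theorem mem_box {N : ℕ} {x : ℤ} : x ∈ box N ↔ -(N : ℤ) ≤ x ∧ x ≤ N := Finset.mem_Icc

theorem mem_bonds {N : ℕ} {b : ℤ} : b ∈ bonds N ↔ -(N : ℤ) ≤ b ∧ b + 1 ≤ N := by
  simp only [bonds, Finset.mem_filter, mem_box]
  omega

theorem exchange_mem_box {N : ℕ} {b : ℤ} (hb : b ∈ bonds N) (a : Bool) {x : ℤ} (hx : x ∈ box N) :
    exchange b a x ∈ box N := by
  rw [mem_bonds] at hb
  rw [mem_box] at hx ⊢
  unfold exchange
  split_ifs <;> omega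

theorem exchange_injective (b : ℤ) (a : Bool) : Function.Injective (exchange b a) := by
  intro x y h
  cases a
  · simpa only [exchange_false] using h
  · simp only [exchange_true] at h
    split_ifs at h <;> omega

theorem touch_exchange_iff {b x y : ℤ} (a : Bool) :
    |exchange b a x - exchange b a y| = 1 ∧ min (exchange b a x) (exchange b a y) = b ↔
      Touch b x y := by
  rw [abs_eq zero_le_one, Touch]
  cases a
  · simp only [exchange_false]
    omega
  · simp only [exchange_true]
    split_ifs <;> omega

section Box

variable {N : ℕ} {ω : Marks} {b : ℤ}

theorem first_mem_markTimes (hb : b ∈ bonds N) : (ω b 0).1 ∈ markTimes N ω :=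
  ⟨b, hb, 0, markTime_zero ω b⟩

theorem mem_markTimes_afterFirst {s : ℝ} (hs : 0 < s) :
    s ∈ markTimes N (afterFirst (bonds N) b ω) ↔ (ω b 0).1 + s ∈ markTimes N ω :=
  exists_congr fun _ => and_congr_right fun hc => isMark_afterFirst_iff hc hs

theorem move_afterFirst {s : ℝ} (hs : 0 < s) (x : ℤ) :
    move N (afterFirst (bonds N) b ω) s x = move N ω ((ω b 0).1 + s) x := by
  have hactive : ∀ c, (c ∈ bonds N ∧ IsActiveMark (afterFirst (bonds N) b ω) c s) ↔
      (c ∈ bonds N ∧ IsActiveMark ω c ((ω b 0).1 + s)) := fun c =>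
    and_congr_right fun hc => isActiveMark_afterFirst_iff hc hs
  classical exact if_congr (hactive x) rfl (if_congr (hactive (x - 1)) rfl rfl)

theorem move_mem_box (ω : Marks) (s : ℝ) {x : ℤ} (hx : x ∈ box N) : move N ω s x ∈ box N := by
  unfold move
  split_ifs with hright hleft
  · exact (Finset.mem_filter.1 hright.1).2
  · exact (Finset.mem_filter.1 hleft.1).1
  · exact hx

theorem position_mem_box (ω : Marks) {x : ℤ} (hx : x ∈ box N) (s : ℝ) :
    position N ω x s ∈ box N := by
  unfold position
  generalize Set.ncard _ = n
  induction n with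
  | zero => exact hx
  | succ n ih => exact move_mem_box ω _ ih

theorem mem_markTimes_of_mem_contactMarks {x y : ℤ} (hx : x ∈ box N) (hy : y ∈ box N)
    {p : ℝ × ℤ × ℤ} (hp : p ∈ contactMarks N x y ω) :
    min p.2.1 p.2.2 ∈ bonds N ∧ p.1 ∈ markTimes N ω := by
  obtain ⟨⟨_, hdist⟩, hpx, hpy, hmark⟩ := hp
  have hx' := mem_box.1 (position_mem_box ω hx p.1)
  have hy' := mem_box.1 (position_mem_box ω hy p.1)
  rw [← hpx] at hx' hdist
  rw [← hpy] at hy' hdist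
  have hmin : min p.2.1 p.2.2 ∈ bonds N := by
    rw [mem_bonds]
    rcases (abs_eq zero_le_one).1 hdist with h | h <;> omega
  exact ⟨hmin, _, hmin, hmark⟩

namespace Regular

theorem pos_of_mem_markTimes (hω : Regular (bonds N) ω) {s : ℝ} (hs : s ∈ markTimes N ω) :
    0 < s := by
  obtain ⟨c, hc, n, rfl⟩ := hs
  exact hω.markTime_pos hc n

theorem first_le (hω : Regular (bonds N) ω) (hf : IsFirst (bonds N) b ω) {s : ℝ}
    (hs : s ∈ markTimes N ω) : (ω b 0).1 ≤ s := by
  obtain ⟨c, hc, n, rfl⟩ := hs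
  exact hω.first_le_markTime hf hc n

theorem isMark_first_iff (hω : Regular (bonds N) ω) (hb : b ∈ bonds N) {c : ℤ}
    (hc : c ∈ bonds N) : IsMark ω c (ω b 0).1 ↔ c = b := by
  simp [IsMark, hω.markTime_eq_first_iff hb hc]

theorem isActiveMark_first_iff (hω : Regular (bonds N) ω) (hb : b ∈ bonds N) {c : ℤ} :
    c ∈ bonds N ∧ IsActiveMark ω c (ω b 0).1 ↔ (ω b 0).2 = true ∧ c = b := by
  constructor
  · rintro ⟨hc, n, htime, hactive⟩
    obtain ⟨rfl, rfl⟩ := (hω.markTime_eq_first_iff hb hc n).1 htime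
    exact ⟨hactive, rfl⟩
  · rintro ⟨hactive, rfl⟩
    exact ⟨hb, 0, markTime_zero ω c, hactive⟩

theorem move_first (hω : Regular (bonds N) ω) (hb : b ∈ bonds N) (x : ℤ) :
    move N ω (ω b 0).1 x = exchange b (ω b 0).2 x := by
  simp only [move, exchange, hω.isActiveMark_first_iff hb, sub_eq_iff_eq_add]
  split_ifs <;> omega

theorem exists_markTime_gt (hω : Regular (bonds N) ω) (hb : b ∈ bonds N) (K : ℝ) :
    {s | s ∈ markTimes N ω ∧ K < s}.Nonempty := by
  obtain ⟨n, hn⟩ := hω.unbounded b hb K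
  exact ⟨_, ⟨b, hb, n, rfl⟩, hn⟩

theorem finite_markTimes (hω : Regular (bonds N) ω) (t : ℝ) :
    {s | s ∈ markTimes N ω ∧ s ≤ t}.Finite := by
  have hfin : ∀ c ∈ bonds N, (markTime ω c '' {n | markTime ω c n ≤ t}).Finite := fun c hc => by
    obtain ⟨n, hn⟩ := hω.unbounded c hc t
    refine ((Set.finite_Iio n).subset fun k hk => ?_).image _
    exact (hω.strictMono hc).lt_iff_lt.1 (lt_of_le_of_lt hk hn)
  refine ((bonds N).finite_toSet.biUnion hfin).subset ?_
  rintro s ⟨⟨c, hc, n, rfl⟩, hst⟩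
  exact Set.mem_biUnion hc ⟨n, hst, rfl⟩

theorem isLeast_epoch_succ (hω : Regular (bonds N) ω) (hb : b ∈ bonds N) (n : ℕ) :
    IsLeast {s | s ∈ markTimes N ω ∧ epoch N ω n < s} (epoch N ω (n + 1)) := by
  obtain ⟨s₀, hs₀⟩ := hω.exists_markTime_gt hb (epoch N ω n)
  have hfin : {s | (s ∈ markTimes N ω ∧ epoch N ω n < s) ∧ s ≤ s₀}.Finite :=
    (hω.finite_markTimes s₀).subset fun s hs => ⟨hs.1.1, hs.2⟩
  obtain ⟨m, ⟨hm, hms₀⟩, hmin⟩ := Set.exists_min_image _ id hfin ⟨s₀, hs₀, le_rfl⟩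
  have hleast : IsLeast {s | s ∈ markTimes N ω ∧ epoch N ω n < s} m :=
    ⟨hm, fun s hs => (le_total s s₀).elim (fun h => hmin s ⟨hs, h⟩) hms₀.trans⟩
  rwa [epoch, hleast.csInf_eq]

theorem epoch_nonneg (hω : Regular (bonds N) ω) (hb : b ∈ bonds N) (n : ℕ) :
    0 ≤ epoch N ω n := by
  induction n with
  | zero => exact le_rfl
  | succ n ih => exact ih.trans (hω.isLeast_epoch_succ hb n).1.2.le

theorem epoch_succ (hω : Regular (bonds N) ω) (hb : b ∈ bonds N)
    (hf : IsFirst (bonds N) b ω) (n : ℕ) :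
    epoch N ω (n + 1) = (ω b 0).1 + epoch N (afterFirst (bonds N) b ω) n := by
  have hω' := hω.regular_afterFirst hf
  induction n with
  | zero =>
    have hleast : IsLeast {s | s ∈ markTimes N ω ∧ 0 < s} (ω b 0).1 :=
      ⟨⟨first_mem_markTimes hb, hω.pos b hb 0⟩, fun s hs => hω.first_le hf hs.1⟩
    simp only [epoch, hleast.csInf_eq, add_zero]
  | succ n ih =>
    have hnonneg := hω'.epoch_nonneg hb n
    obtain ⟨⟨hmark, hlt⟩, hmin⟩ := hω'.isLeast_epoch_succ hb n
    refine IsLeast.csInf_eq ⟨⟨?_, ?_⟩, fun s hs => ?_⟩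
    · exact (mem_markTimes_afterFirst (hnonneg.trans_lt hlt)).1 hmark
    · rwa [ih, add_lt_add_iff_left]
    · obtain ⟨hs, hs'⟩ := hs
      rw [ih, ← lt_sub_iff_add_lt'] at hs'
      rw [← le_sub_iff_add_le']
      refine hmin ⟨?_, hs'⟩
      rwa [mem_markTimes_afterFirst (hnonneg.trans_lt hs'), add_sub_cancel]

theorem skeleton_succ (hω : Regular (bonds N) ω) (hb : b ∈ bonds N)
    (hf : IsFirst (bonds N) b ω) (x : ℤ) (n : ℕ) :
    skeleton N ω x (n + 1) =
      skeleton N (afterFirst (bonds N) b ω) (exchange b (ω b 0).2 x) n := by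
  have hω' := hω.regular_afterFirst hf
  induction n with
  | zero =>
    simp only [skeleton]
    rw [hω.epoch_succ hb hf, epoch, add_zero, hω.move_first hb]
  | succ n ih =>
    have hpos : 0 < epoch N (afterFirst (bonds N) b ω) (n + 1) :=
      hω'.pos_of_mem_markTimes (hω'.isLeast_epoch_succ hb n).1.1
    rw [skeleton, ih, hω.epoch_succ hb hf, skeleton, move_afterFirst hpos]

theorem position_of_lt (hω : Regular (bonds N) ω) (hf : IsFirst (bonds N) b ω) (x : ℤ)
    {s : ℝ} (hs : s < (ω b 0).1) : position N ω x s = x := by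
  have hempty : {u | u ∈ markTimes N ω ∧ 0 < u ∧ u ≤ s} = ∅ :=
    Set.eq_empty_of_forall_notMem fun u hu => (hs.trans_le (hω.first_le hf hu.1)).not_ge hu.2.2
  rw [position, hempty, Set.ncard_empty, skeleton]

theorem markTimes_le_add (hω : Regular (bonds N) ω) (hb : b ∈ bonds N)
    (hf : IsFirst (bonds N) b ω) {s : ℝ} (hs : 0 ≤ s) :
    {u | u ∈ markTimes N ω ∧ 0 < u ∧ u ≤ (ω b 0).1 + s} = insert (ω b 0).1
      (((ω b 0).1 + ·) '' {v | v ∈ markTimes N (afterFirst (bonds N) b ω) ∧ 0 < v ∧ v ≤ s}) := by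
  have hfirst := hω.pos b hb 0
  ext u
  simp only [Set.mem_ofPred_eq, Set.mem_insert_iff, Set.mem_image]
  constructor
  · rintro ⟨hu, _, hus⟩
    rcases (hω.first_le hf hu).eq_or_lt with h | h
    · exact Or.inl h.symm
    · refine Or.inr ⟨u - (ω b 0).1, ⟨?_, sub_pos.2 h, by linarith⟩, by ring⟩
      rwa [mem_markTimes_afterFirst (sub_pos.2 h), add_sub_cancel]
  · rintro (rfl | ⟨v, ⟨hv, hv0, hvs⟩, rfl⟩)
    · exact ⟨first_mem_markTimes hb, hfirst, by linarith⟩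
    · exact ⟨(mem_markTimes_afterFirst hv0).1 hv, by linarith, by linarith⟩

theorem position_add (hω : Regular (bonds N) ω) (hb : b ∈ bonds N)
    (hf : IsFirst (bonds N) b ω) (x : ℤ) {s : ℝ} (hs : 0 ≤ s) :
    position N ω x ((ω b 0).1 + s) =
      position N (afterFirst (bonds N) b ω) (exchange b (ω b 0).2 x) s := by
  have hfin : {v | v ∈ markTimes N (afterFirst (bonds N) b ω) ∧ 0 < v ∧ v ≤ s}.Finite :=
    ((hω.regular_afterFirst hf).finite_markTimes s).subset fun v hv => ⟨hv.1, hv.2.2⟩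
  rw [position, hω.markTimes_le_add hb hf hs, Set.ncard_insert_of_notMem _ (hfin.image _),
    Set.ncard_image_of_injective _ (add_right_injective _), hω.skeleton_succ hb hf, position]
  rintro ⟨v, ⟨_, hv, _⟩, hv'⟩
  exact hv.ne' (add_eq_left.1 hv')

theorem position_first (hω : Regular (bonds N) ω) (hb : b ∈ bonds N)
    (hf : IsFirst (bonds N) b ω) (x : ℤ) :
    position N ω x (ω b 0).1 = exchange b (ω b 0).2 x := by
  have hω' := hω.regular_afterFirst hf
  obtain ⟨c, hc, hfc⟩ := hω'.exists_isFirst ⟨b, hb⟩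
  rw [← add_zero (ω b 0).1, hω.position_add hb hf x le_rfl]
  exact hω'.position_of_lt hfc _ (hω'.pos c hc 0)

theorem add_mem_contactMarks_iff (hω : Regular (bonds N) ω) (hb : b ∈ bonds N)
    (hf : IsFirst (bonds N) b ω) {x y : ℤ} (hx : x ∈ box N) (hy : y ∈ box N) {s : ℝ} (hs : 0 < s)
    (z : ℤ × ℤ) :
    ((ω b 0).1 + s, z) ∈ contactMarks N x y ω ↔
      (s, z) ∈ contactMarks N (exchange b (ω b 0).2 x) (exchange b (ω b 0).2 y)
        (afterFirst (bonds N) b ω) := by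
  have hiff (hz : min z.1 z.2 ∈ bonds N) : ((ω b 0).1 + s, z) ∈ contactMarks N x y ω ↔
      (s, z) ∈ contactMarks N (exchange b (ω b 0).2 x) (exchange b (ω b 0).2 y)
        (afterFirst (bonds N) b ω) := by
    have hnonneg : 0 ≤ (ω b 0).1 + s := add_nonneg (hω.pos b hb 0).le hs.le
    simp only [contactMarks, contactTimes, Set.mem_ofPred_eq, hω.position_add hb hf _ hs.le,
      hnonneg, hs.le, true_and, isMark_afterFirst_iff hz hs]
  have hx' := exchange_mem_box hb (ω b 0).2 hx
  have hy' := exchange_mem_box hb (ω b 0).2 hy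
  exact ⟨fun h => (hiff (mem_markTimes_of_mem_contactMarks hx hy h).1).1 h,
    fun h => (hiff (mem_markTimes_of_mem_contactMarks hx' hy' h).1).2 h⟩

theorem first_mem_contactMarks_iff (hω : Regular (bonds N) ω) (hb : b ∈ bonds N)
    (hf : IsFirst (bonds N) b ω) {x y : ℤ} (hx : x ∈ box N) (hy : y ∈ box N) (z : ℤ × ℤ) :
    ((ω b 0).1, z) ∈ contactMarks N x y ω ↔
      Touch b x y ∧ z = (exchange b (ω b 0).2 x, exchange b (ω b 0).2 y) := by
  rw [← touch_exchange_iff (ω b 0).2]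
  constructor
  · intro h
    have hmin := (mem_markTimes_of_mem_contactMarks hx hy h).1
    obtain ⟨⟨_, hdist⟩, hzx, hzy, hmark⟩ := h
    simp only [hω.position_first hb hf] at hdist hzx hzy hmark hmin
    rw [hzx, hzy] at hmark hmin
    exact ⟨⟨hdist, (hω.isMark_first_iff hb hmin).1 hmark⟩, Prod.ext hzx hzy⟩
  · rintro ⟨⟨hdist, hmin⟩, rfl⟩
    simp only [contactMarks, contactTimes, Set.mem_ofPred_eq, hω.position_first hb hf, hmin,
      hω.isMark_first_iff hb hb, and_true]
    exact ⟨(hω.pos b hb 0).le, hdist⟩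

end Regular

end Box

end Paths

section AlmostSure

variable {ε : ℝ}

theorem measurePreserving_eval_marksLaw (hε : 0 < ε) (b : ℤ) :
    MeasurePreserving (fun ω : Marks => ω b) (marksLaw ε) (seqLaw ε) := by
  have := isProbabilityMeasure_seqLaw hε
  exact measurePreserving_eval_infinitePi (fun _ : ℤ => seqLaw ε) b

theorem ae_wait_pos (hε : 0 < ε) (b : ℤ) (n : ℕ) : ∀ᵐ ω ∂(marksLaw ε), 0 < (ω b n).1 := by
  have := isProbabilityMeasure_markLaw hε
  have := isProbabilityMeasure_waitLaw hε
  have hwait : ∀ᵐ x ∂(expMeasure (ε⁻¹ ^ 2)), x ∈ Set.Ioi 0 := by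
    refine (prob_compl_eq_zero_iff measurableSet_Ioi).2 ?_
    rw [expMeasure_Ioi (by positivity) le_rfl]
    simp
  have hmark : ∀ᵐ e ∂(markLaw ε), 0 < e.1 := measurePreserving_fst.quasiMeasurePreserving.ae hwait
  have hseq : ∀ᵐ q ∂(seqLaw ε), 0 < (q n).1 :=
    (measurePreserving_eval_infinitePi (fun _ : ℕ => markLaw ε) n).quasiMeasurePreserving.ae hmark
  exact (measurePreserving_eval_marksLaw hε b).quasiMeasurePreserving.ae hseq

theorem markLaw_wait_le_lt_one (hε : 0 < ε) {K : ℝ} (hK : 0 ≤ K) :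
    markLaw ε {e | e.1 ≤ K} < 1 := by
  have := isProbabilityMeasure_waitLaw hε
  have hset : {e : ℝ × Bool | e.1 ≤ K} = (Set.Ioi K)ᶜ ×ˢ Set.univ := by ext; simp
  rw [hset, markLaw, prod_prod, measure_univ, mul_one, prob_compl_eq_one_sub measurableSet_Ioi,
    expMeasure_Ioi (by positivity) hK]
  exact ENNReal.sub_lt_self ENNReal.one_ne_top one_ne_zero
    (ENNReal.ofReal_pos.2 (Real.exp_pos _)).ne'

theorem seqLaw_forall_wait_le (hε : 0 < ε) {K : ℝ} (hK : 0 ≤ K) :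
    seqLaw ε {q | ∀ n, (q n).1 ≤ K} = 0 := by
  have := isProbabilityMeasure_markLaw hε
  have hle : ∀ n, seqLaw ε {q | ∀ n, (q n).1 ≤ K} ≤ markLaw ε {e | e.1 ≤ K} ^ n := fun n => by
    have hpi := infinitePi_pi (fun _ : ℕ => markLaw ε) (s := Finset.range n)
      (t := fun _ => {e | e.1 ≤ K}) (fun _ _ => measurableSet_le measurable_fst measurable_const)
    rw [Finset.prod_const, Finset.card_range] at hpi
    rw [← hpi]
    exact measure_mono fun q hq i _ => hq i
  exact nonpos_iff_eq_zero.1 (ge_of_tendsto'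
    (ENNReal.tendsto_pow_atTop_nhds_zero_of_lt_one (markLaw_wait_le_lt_one hε hK)) hle)

theorem ae_markTime_unbounded (hε : 0 < ε) (b : ℤ) :
    ∀ᵐ ω ∂(marksLaw ε), ∀ K : ℝ, ∃ n, K < markTime ω b n := by
  have hwait : ∀ K : ℕ, ∀ᵐ ω ∂(marksLaw ε), ∃ n, (K : ℝ) < (ω b n).1 := fun K => by
    have hseq : ∀ᵐ q ∂(seqLaw ε), ∃ n, (K : ℝ) < (q n).1 := by
      rw [ae_iff]
      simpa using seqLaw_forall_wait_le hε K.cast_nonneg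
    exact (measurePreserving_eval_marksLaw hε b).quasiMeasurePreserving.ae hseq
  filter_upwards [ae_all_iff.2 hwait, ae_all_iff.2 (ae_wait_pos hε b)] with ω hω hpos K
  obtain ⟨k, hk⟩ := exists_nat_gt K
  obtain ⟨n, hn⟩ := hω k
  refine ⟨n, hk.trans (hn.trans_le ?_)⟩
  exact Finset.single_le_sum (f := fun i => (ω b i).1) (fun i _ => (hpos i).le)
    (Finset.self_mem_range_succ n)

/-- Given all other waiting times, the first one at the pair `b` has no atoms. -/
theorem ae_markTime_ne (hε : 0 < ε) {b c : ℤ} (hbc : b ≠ c) (m n : ℕ) :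
    ∀ᵐ ω ∂(marksLaw ε), markTime ω b m ≠ markTime ω c n := by
  have := isProbabilityMeasure_markLaw hε
  have := isProbabilityMeasure_marksLaw hε
  have := isProbabilityMeasure_waitLaw hε
  have hmeas : MeasurableSet {ω : Marks | markTime ω b m = markTime ω c n} :=
    measurableSet_eq_fun (by unfold markTime; fun_prop) (by unfold markTime; fun_prop)
  have hatom : ∀ x, markLaw ε {e | e.1 = x} = 0 := fun x => by
    have hset : {e : ℝ × Bool | e.1 = x} = {x} ×ˢ Set.univ := by ext; simp
    rw [hset, markLaw, prod_prod, measure_singleton, zero_mul]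
  have hins := measurePreserving_insertMark hε b
  simp only [ae_iff, not_not]
  rw [← hins.measure_preimage hmeas.nullMeasurableSet, prod_apply (hins.measurable hmeas)]
  refine lintegral_eq_zero_of_ae_eq_zero (.of_forall fun ω => ?_)
  refine measure_mono_null (fun e he => ?_)
    (hatom (markTime ω c n - ∑ i ∈ Finset.range m, (ω b i).1))
  simp only [Set.mem_preimage, Set.mem_ofPred_eq, markTime, insertMark_of_ne hbc.symm] at he ⊢
  rw [Finset.sum_range_succ'] at he
  simp only [insertMark_self_succ, insertMark_self_zero] at he
  linarith

theorem ae_regular (hε : 0 < ε) (B : Finset ℤ) : ∀ᵐ ω ∂(marksLaw ε), Regular B ω := by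
  have hpos : ∀ᵐ ω ∂(marksLaw ε), ∀ b n, 0 < (ω b n).1 :=
    ae_all_iff.2 fun b => ae_all_iff.2 (ae_wait_pos hε b)
  have hunbounded : ∀ᵐ ω ∂(marksLaw ε), ∀ b, ∀ K : ℝ, ∃ n, K < markTime ω b n :=
    ae_all_iff.2 (ae_markTime_unbounded hε)
  have hne : ∀ᵐ ω ∂(marksLaw ε), ∀ b c : ℤ, b ≠ c → ∀ m n, markTime ω b m ≠ markTime ω c n :=
    ae_all_iff.2 fun b => ae_all_iff.2 fun c => ae_all_iff.2 fun hbc => ae_all_iff.2 fun m =>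
      ae_all_iff.2 (ae_markTime_ne hε hbc m)
  filter_upwards [hpos, hunbounded, hne] with ω hpos hunbounded hne
  exact ⟨fun b _ => hpos b, fun b _ => hunbounded b, fun b _ c _ => hne b c⟩

end AlmostSure

section PairChain

variable {N : ℕ} {ω : Marks} {b x y : ℤ} {t : ℝ}

theorem bonds_nonempty (hN : 1 ≤ N) : (bonds N).Nonempty :=
  ⟨0, mem_bonds.2 ⟨by omega, by omega⟩⟩

theorem le_tau_iff : (t : EReal) ≤ tau N x y ω ↔ ∀ p ∈ contactMarks N x y ω, t ≤ p.1 := by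
  simp [tau, le_iInf_iff]

/-- The states of the pair of particles up to the first mark between them (`dead`), or the first
time when their distance reaches a given value (`escaped`). -/
inductive PairState
  | dead
  | escaped
  | live (x y : ℤ)

/-- Effect on the `PairState`, with escape at distance `M`, of a mark with attribute `a` at the
pair `{b, b + 1}`. -/
def PairState.step (M : ℕ) : PairState → ℤ → Bool → PairState
  | .dead, _, _ => .dead
  | .escaped, _, _ => .escaped
  | .live x y, b, a =>
    if Touch b x y then .dead
    else if (M : ℤ) ≤ |exchange b a x - exchange b a y| then .escaped
    else .live (exchange b a x) (exchange b a y)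

/-- Effect of a mark with attribute `a` at the pair `{b, b + 1}` on the number of marks between the
two particles that are still to come and on the positions of the particles. -/
def countStep : ℕ × ℤ × ℤ → ℤ → Bool → ℕ × ℤ × ℤ
  | (j, x, y), b, a => (if Touch b x y then j - 1 else j, exchange b a x, exchange b a y)

namespace Regular

theorem mem_chainEvent_of_forall_step_eq {ι : Type*} {B : Finset ℤ} {F : Set ι}
    {step : ι → ℤ → Bool → ι} {i : ι} (hB : B.Nonempty) (hi : i ∈ F)
    (hstep : ∀ b a, step i b a = i) (hω : Regular B ω) (n : ℕ) (t : ℝ) :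
    ω ∈ chainEvent B F step n i t := by
  induction n generalizing ω t with
  | zero => trivial
  | succ n ih =>
    obtain ⟨b, hb, hf⟩ := hω.exists_isFirst hB
    rcases le_total t (ω b 0).1 with h | h
    · exact .inl ⟨hi, fun c hc => h.trans (hf.first_le_wait hc)⟩
    · refine .inr ⟨b, hb, hf, h, ?_⟩
      rw [hstep]
      exact ih (hω.regular_afterFirst hf) _

theorem le_tau_afterFirst (hω : Regular (bonds N) ω) (hb : b ∈ bonds N)
    (hf : IsFirst (bonds N) b ω) (hx : x ∈ box N) (hy : y ∈ box N)
    (ht : (t : EReal) ≤ tau N x y ω) :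
    ((t - (ω b 0).1 : ℝ) : EReal) ≤ tau N (exchange b (ω b 0).2 x) (exchange b (ω b 0).2 y)
      (afterFirst (bonds N) b ω) := by
  rw [le_tau_iff] at ht ⊢
  rintro ⟨s, z⟩ hp
  have hs := (hω.regular_afterFirst hf).pos_of_mem_markTimes (mem_markTimes_of_mem_contactMarks
    (exchange_mem_box hb _ hx) (exchange_mem_box hb _ hy) hp).2
  exact sub_le_iff_le_add'.2 (ht _ ((hω.add_mem_contactMarks_iff hb hf hx hy hs z).2 hp))

theorem mem_chainEvent_of_le_tau (M : ℕ) (hN : 1 ≤ N) (hω : Regular (bonds N) ω) (n : ℕ)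
    (hx : x ∈ box N) (hy : y ∈ box N) (ht : (t : EReal) ≤ tau N x y ω) :
    ω ∈ chainEvent (bonds N) {PairState.dead}ᶜ (PairState.step M) n (.live x y) t := by
  induction n generalizing ω t x y with
  | zero => trivial
  | succ n ih =>
    obtain ⟨b, hb, hf⟩ := hω.exists_isFirst (bonds_nonempty hN)
    have hω' := hω.regular_afterFirst hf
    rcases le_or_gt t (ω b 0).1 with h | h
    · exact .inl ⟨by simp, fun c hc => h.trans (hf.first_le_wait hc)⟩
    · refine .inr ⟨b, hb, hf, h.le, ?_⟩
      have htouch : ¬Touch b x y := fun htouch => h.not_ge <| le_tau_iff.1 ht _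
        ((hω.first_mem_contactMarks_iff hb hf hx hy _).2 ⟨htouch, rfl⟩)
      rw [PairState.step, if_neg htouch]
      split_ifs
      · exact hω'.mem_chainEvent_of_forall_step_eq (bonds_nonempty hN) (by simp)
          (fun _ _ => rfl) n _
      · exact ih hω' (exchange_mem_box hb _ hx) (exchange_mem_box hb _ hy)
          (hω.le_tau_afterFirst hb hf hx hy ht)

theorem numMarks_le (hω : Regular (bonds N) ω) (hb : b ∈ bonds N) (hf : IsFirst (bonds N) b ω)
    (hx : x ∈ box N) (hy : y ∈ box N) (t : ℝ) :
    numMarks N x y t ω ≤ (if Touch b x y then 1 else 0) +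
      numMarks N (exchange b (ω b 0).2 x) (exchange b (ω b 0).2 y) (t - (ω b 0).1)
        (afterFirst (bonds N) b ω) := by
  let x' := exchange b (ω b 0).2 x
  let y' := exchange b (ω b 0).2 y
  let atFirst : Set (ℝ × ℤ × ℤ) := if Touch b x y then {((ω b 0).1, x', y')} else ∅
  have hatFirst : atFirst.encard ≤ if Touch b x y then 1 else 0 := by
    simp only [atFirst]
    split_ifs <;> simp
  have hsub : {p | p ∈ contactMarks N x y ω ∧ p.1 ≤ t} ⊆ atFirst ∪
      (fun p : ℝ × ℤ × ℤ => ((ω b 0).1 + p.1, p.2)) ''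
        {p | p ∈ contactMarks N x' y' (afterFirst (bonds N) b ω) ∧ p.1 ≤ t - (ω b 0).1} := by
    rintro ⟨s, z⟩ ⟨hp, hst⟩
    rcases (hω.first_le hf (mem_markTimes_of_mem_contactMarks hx hy hp).2).eq_or_lt with rfl | hs
    · obtain ⟨htouch, rfl⟩ := (hω.first_mem_contactMarks_iff hb hf hx hy z).1 hp
      left
      simp [atFirst, htouch, x', y']
    · refine .inr ⟨(s - (ω b 0).1, z), ⟨?_, sub_le_sub_right hst _⟩, by simp⟩
      rwa [← hω.add_mem_contactMarks_iff hb hf hx hy (sub_pos.2 hs), add_sub_cancel]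
  calc numMarks N x y t ω ≤ _ := Set.encard_le_encard hsub
    _ ≤ _ := Set.encard_union_le _ _
    _ ≤ _ := add_le_add hatFirst (Set.encard_image_le _ _)

theorem first_le_of_numMarks_ne_zero (hω : Regular (bonds N) ω) (hf : IsFirst (bonds N) b ω)
    (hx : x ∈ box N) (hy : y ∈ box N) (h : numMarks N x y t ω ≠ 0) : (ω b 0).1 ≤ t := by
  obtain ⟨p, hp, hpt⟩ := Set.encard_ne_zero.1 h
  exact (hω.first_le hf (mem_markTimes_of_mem_contactMarks hx hy hp).2).trans hpt

theorem mem_chainEvent_of_le_numMarks (hN : 1 ≤ N) (hω : Regular (bonds N) ω) (n : ℕ) {j : ℕ}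
    (hx : x ∈ box N) (hy : y ∈ box N) (hj : (j : ℕ∞) ≤ numMarks N x y t ω) :
    ω ∈ chainEvent (bonds N) {i | i.1 = 0} countStep n (j, x, y) t := by
  induction n generalizing ω t x y j with
  | zero => trivial
  | succ n ih =>
    obtain ⟨b, hb, hf⟩ := hω.exists_isFirst (bonds_nonempty hN)
    by_cases hstay : j = 0 ∧ t ≤ (ω b 0).1
    · exact .inl ⟨hstay.1, fun c hc => hstay.2.trans (hf.first_le_wait hc)⟩
    have hle : (ω b 0).1 ≤ t := by
      rcases eq_or_ne j 0 with rfl | hj0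
      · exact (not_le.1 fun h => hstay ⟨rfl, h⟩).le
      · refine hω.first_le_of_numMarks_ne_zero hf hx hy fun h => hj0 ?_
        rwa [h, nonpos_iff_eq_zero, Nat.cast_eq_zero] at hj
    refine .inr ⟨b, hb, hf, hle, ih (hω.regular_afterFirst hf) (exchange_mem_box hb _ hx)
      (exchange_mem_box hb _ hy) ?_⟩
    have hcount := hj.trans (hω.numMarks_le hb hf hx hy t)
    split_ifs at hcount ⊢
    · rw [ENat.natCast_sub, Nat.cast_one]
      exact tsub_le_iff_left.2 hcount
    · rwa [zero_add] at hcount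

end Regular

end PairChain

section Generator

variable {N : ℕ} {b x y : ℤ}

theorem touch_comm : Touch b x y ↔ Touch b y x := by unfold Touch; omega

theorem touch_iff_of_lt (hxy : x < y) : Touch b x y ↔ b = x ∧ y = x + 1 := by
  unfold Touch; omega

theorem sum_bonds_exchange (hx : x ∈ box N) (H : ℤ → ℝ) :
    ∑ b ∈ bonds N, (H (exchange b true x) - H x) =
      (if x < N then H (x + 1) - H x else 0) + (if -(N : ℤ) < x then H (x - 1) - H x else 0) := by
  have hstep : ∀ b ∈ bonds N, H (exchange b true x) - H x =
      (if b = x then H (x + 1) - H x else 0) + (if b = x - 1 then H (x - 1) - H x else 0) := by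
    intro b _
    rcases eq_or_ne x b with rfl | hxb
    · simp [exchange_true, show x ≠ x - 1 by omega]
    rcases eq_or_ne x (b + 1) with rfl | hxb'
    · simp [exchange_true]
    · simp [exchange_true, hxb, hxb', hxb.symm, show b ≠ x - 1 by omega]
  rw [mem_box] at hx
  have hright : x ∈ bonds N ↔ x < N := by rw [mem_bonds]; omega
  have hleft : x - 1 ∈ bonds N ↔ -(N : ℤ) < x := by rw [mem_bonds]; omega
  simp only [Finset.sum_congr rfl hstep, Finset.sum_add_distrib, Finset.sum_ite_eq', hright, hleft]

theorem exchange_eq_or_eq_of_not_touch (hxy : x < y) (hb : ¬Touch b x y) :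
    exchange b true x = x ∨ exchange b true y = y := by
  rw [touch_iff_of_lt hxy] at hb
  simp only [exchange_true]
  split_ifs <;> omega

/-- A mark not between the two particles moves at most one of them, so that the increment splits
into two increments for one particle, up to the term of the pair of sites that the particles may
occupy. -/
theorem ite_touch_gap_increment (hxy : x < y) (F : ℤ → ℝ) (κ : ℝ) (b : ℤ) :
    (if Touch b x y then κ else F |exchange b true x - exchange b true y| - F |x - y|) =
      (F |exchange b true x - y| - F |x - y|) + (F |x - exchange b true y| - F |x - y|) +
        if b = x then (if y = x + 1 then κ - 2 * (F 0 - F 1) else 0) else 0 := by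
  by_cases hb : Touch b x y
  · obtain ⟨rfl, rfl⟩ := (touch_iff_of_lt hxy).1 hb
    simp only [hb, ↓reduceIte, exchange_true, sub_self, abs_zero, sub_add_cancel_left,
      Int.reduceNeg, abs_neg, abs_one, add_eq_left, one_ne_zero]
    ring
  · have hcorr : (if b = x then (if y = x + 1 then κ - 2 * (F 0 - F 1) else 0) else 0) = 0 := by
      rw [← ite_and, if_neg (mt (touch_iff_of_lt hxy).2 hb)]
    rw [if_neg hb, hcorr]
    rcases exchange_eq_or_eq_of_not_touch hxy hb with h | h <;> simp [h]

theorem sum_bonds_gap (hx : x ∈ box N) (hy : y ∈ box N) (hxy : x < y) (F : ℤ → ℝ) (κ : ℝ) :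
    ∑ b ∈ bonds N, (if Touch b x y then κ
        else F |exchange b true x - exchange b true y| - F |x - y|) =
      (if y = x + 1 then κ else 2 * (F (y - x - 1) - F (y - x))) +
      ((if -(N : ℤ) < x then 1 else 0) + (if y < N then 1 else 0)) *
        (F (y - x + 1) - F (y - x)) := by
  have hdist : |x - y| = y - x := by rw [abs_sub_comm, abs_of_pos (sub_pos.2 hxy)]
  have hxN := mem_box.1 hx
  have hyN := mem_box.1 hy
  have hxb : x ∈ bonds N := by rw [mem_bonds]; omega
  rw [Finset.sum_congr rfl fun b _ => ite_touch_gap_increment hxy F κ b,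
    Finset.sum_add_distrib, Finset.sum_add_distrib,
    sum_bonds_exchange hx fun z => F |z - y|, sum_bonds_exchange hy fun z => F |x - z|,
    Finset.sum_ite_eq', if_pos hxb, if_pos (by omega : x < N), if_pos (by omega : -(N : ℤ) < y),
    hdist, show |x + 1 - y| = y - x - 1 by rw [abs_of_nonpos] <;> omega,
    show |x - 1 - y| = y - x + 1 by rw [abs_of_nonpos] <;> omega,
    show |x - (y + 1)| = y - x + 1 by rw [abs_of_nonpos] <;> omega,
    show |x - (y - 1)| = y - x - 1 by rw [abs_of_nonpos] <;> omega]
  rcases eq_or_ne y (x + 1) with rfl | hadj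
  · simp only [add_sub_cancel_left, sub_self, Int.reduceAdd, ↓reduceIte]
    split_ifs <;> ring
  · simp only [hadj, if_false]
    split_ifs <;> ring

end Generator

section FirstMark

variable {N M : ℕ} {s ρ : ℝ} {x y : ℤ}

/-- A bound for the probability that two particles at distance `d` have no mark between them during
a time `s` of which `ρ` has passed, time being counted in units of `ε²`. The summand `d / M`
accounts for the event that the distance reaches `M` first, the other one is Markov's inequality for
the time when the distance leaves `(0, M)`. -/
def gapBound (M : ℕ) (s ρ d : ℝ) : ℝ := d / M + (d * (M - d) / 2 + ρ) / s

/-- The bound `gapBound`, replaced by `1` when the distance is at least `M`. -/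
def cappedGapBound (M : ℕ) (s ρ : ℝ) (d : ℤ) : ℝ := if (M : ℤ) ≤ d then 1 else gapBound M s ρ d

/-- The supersolution for the first mark between the particles. -/
def survivalBound (M : ℕ) (s ρ : ℝ) : PairState → ℝ
  | .dead => 0
  | .escaped => 1
  | .live x y => gapBound M s ρ ((|x - y| : ℤ) : ℝ)

/-- The states of two different particles in `Λ_N`, with escape at distance `M`. -/
def survivalStates (N M : ℕ) : Set PairState
  | .dead => True
  | .escaped => True
  | .live x y => x ∈ box N ∧ y ∈ box N ∧ x ≠ y ∧ |x - y| < M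

theorem gapBound_nonneg (hs : 0 ≤ s) (hρ : 0 ≤ ρ) {d : ℝ} (hd : 0 ≤ d) (hdM : d ≤ M) :
    0 ≤ gapBound M s ρ d := by
  have := sub_nonneg.2 hdM
  unfold gapBound
  positivity

theorem one_le_gapBound_self (hs : 0 < s) {d : ℝ} (hd : 0 ≤ d) (hdM : d ≤ M) :
    1 ≤ gapBound M s s d := by
  have hle : s / s ≤ (d * (M - d) / 2 + s) / s := by
    gcongr
    exact le_add_of_nonneg_left (by have := sub_nonneg.2 hdM; positivity)
  rw [div_self hs.ne'] at hle
  exact hle.trans (le_add_of_nonneg_left (by positivity))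

theorem gapBound_second_difference (hs : s ≠ 0) (hM : M ≠ 0) (ρ d : ℝ) :
    (gapBound M s ρ (d - 1) - gapBound M s ρ d) + (gapBound M s ρ (d + 1) - gapBound M s ρ d) =
      -(1 / s) := by
  unfold gapBound
  field_simp
  ring

theorem gapBound_le_gapBound_add_one (hM : 1 ≤ M) (hs : (M : ℝ) ^ 2 ≤ s) {d : ℝ}
    (hd : d + 1 ≤ M) : gapBound M s ρ d ≤ gapBound M s ρ (d + 1) := by
  have hM0 : (1 : ℝ) ≤ M := by exact_mod_cast hM
  have hs0 : 0 < s := lt_of_lt_of_le (by positivity) hs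
  have hdiff : gapBound M s ρ (d + 1) - gapBound M s ρ d = 1 / M - (2 * d + 1 - M) / (2 * s) := by
    unfold gapBound
    field_simp
    ring
  have hslope : (2 * d + 1 - M) / (2 * s) ≤ 1 / M := by
    rw [div_le_div_iff₀ (by positivity) (by positivity)]
    nlinarith
  linarith

theorem cappedGapBound_le_gapBound (hM : 1 ≤ M) (hs : 0 ≤ s) (hρ : 0 ≤ ρ) {d : ℤ} (hd : d ≤ M) :
    cappedGapBound M s ρ d ≤ gapBound M s ρ d := by
  unfold cappedGapBound
  split_ifs with h
  · have hM0 : (M : ℝ) ≠ 0 := by exact_mod_cast (by omega : M ≠ 0)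
    obtain rfl := le_antisymm hd h
    rw [gapBound, Int.cast_natCast, div_self hM0, sub_self, mul_zero, zero_div, zero_add]
    exact le_add_of_nonneg_right (by positivity)
  · exact le_rfl

theorem cappedGapBound_generator_of_lt (hM : 1 ≤ M) (hs : (M : ℝ) ^ 2 ≤ s) (hρ : 0 ≤ ρ)
    (hx : x ∈ box N) (hy : y ∈ box N) (hxy : x < y) (hd : y - x < M) :
    ∑ b ∈ bonds N, (if Touch b x y then -2 * cappedGapBound M s ρ |x - y| else
      cappedGapBound M s ρ |exchange b true x - exchange b true y| -
        cappedGapBound M s ρ |x - y|) ≤ -(2 / s) := by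
  have hs0 : 0 < s := lt_of_lt_of_le (by positivity) hs
  rw [sum_bonds_gap hx hy hxy, abs_sub_comm, abs_of_pos (sub_pos.2 hxy)]
  obtain ⟨d, hdef⟩ : ∃ d, d = y - x := ⟨_, rfl⟩
  rw [← hdef] at hd ⊢
  have hdM : (d : ℝ) + 1 ≤ M := by exact_mod_cast (by omega : d + 1 ≤ M)
  have hhere : cappedGapBound M s ρ d = gapBound M s ρ d := if_neg hd.not_ge
  have hcloser : (if y = x + 1 then -2 * cappedGapBound M s ρ d
      else 2 * (cappedGapBound M s ρ (d - 1) - cappedGapBound M s ρ d)) ≤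
      2 * (gapBound M s ρ (d - 1) - gapBound M s ρ d) := by
    have hnonneg : 0 ≤ gapBound M s ρ (d - 1) :=
      gapBound_nonneg hs0.le hρ (by exact_mod_cast (by omega : 0 ≤ d - 1)) (by linarith)
    have hle := cappedGapBound_le_gapBound hM hs0.le hρ (by omega : d - 1 ≤ M)
    push_cast at hle
    split_ifs <;> linarith
  have hfarther : ((if -(N : ℤ) < x then 1 else 0) + (if y < N then 1 else 0)) *
      (cappedGapBound M s ρ (d + 1) - cappedGapBound M s ρ d) ≤
      2 * (gapBound M s ρ (d + 1) - gapBound M s ρ d) := by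
    have hmono : gapBound M s ρ d ≤ gapBound M s ρ (d + 1) := gapBound_le_gapBound_add_one hM hs hdM
    have hle := cappedGapBound_le_gapBound hM hs0.le hρ (by omega : d + 1 ≤ M)
    push_cast at hle
    split_ifs <;> linarith
  have hsecond := gapBound_second_difference hs0.ne' (by omega : M ≠ 0) ρ d
  linarith [(by ring : 2 / s = 2 * (1 / s))]

theorem cappedGapBound_generator (hM : 1 ≤ M) (hs : (M : ℝ) ^ 2 ≤ s) (hρ : 0 ≤ ρ)
    (hx : x ∈ box N) (hy : y ∈ box N) (hxy : x ≠ y) (hd : |x - y| < M) :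
    ∑ b ∈ bonds N, (if Touch b x y then -2 * cappedGapBound M s ρ |x - y| else
      cappedGapBound M s ρ |exchange b true x - exchange b true y| -
        cappedGapBound M s ρ |x - y|) ≤ -(2 / s) := by
  wlog h : x < y generalizing x y
  · simpa only [touch_comm (x := y), abs_sub_comm y x,
      fun b => abs_sub_comm (exchange b true y) (exchange b true x)] using
      this hy hx hxy.symm (abs_sub_comm x y ▸ hd) (lt_of_le_of_ne (not_lt.1 h) hxy.symm)
  · exact cappedGapBound_generator_of_lt hM hs hρ hx hy h
      (by rwa [abs_sub_comm, abs_of_pos (sub_pos.2 h)] at hd)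

theorem sum_survivalBound_step (hd : |x - y| < M) (b : ℤ) :
    ∑ a : Bool, (survivalBound M s ρ (PairState.step M (.live x y) b a) -
      survivalBound M s ρ (.live x y)) =
    if Touch b x y then -2 * cappedGapBound M s ρ |x - y| else
      cappedGapBound M s ρ |exchange b true x - exchange b true y| -
        cappedGapBound M s ρ |x - y| := by
  simp only [Fintype.sum_bool, PairState.step, exchange_false, cappedGapBound, if_neg hd.not_ge]
  by_cases htouch : Touch b x y
  · simp only [htouch, if_true, survivalBound]
    ring
  · simp only [htouch, if_false, sub_self, add_zero]
    split_ifs <;> simp [survivalBound]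

theorem step_mem_survivalStates {i : PairState} (hi : i ∈ survivalStates N M) {b : ℤ}
    (hb : b ∈ bonds N) (a : Bool) : PairState.step M i b a ∈ survivalStates N M := by
  rcases i with _ | _ | ⟨x, y⟩
  · trivial
  · trivial
  · obtain ⟨hx, hy, hxy, -⟩ := hi
    simp only [PairState.step]
    split_ifs with htouch hescape
    · trivial
    · trivial
    · exact ⟨exchange_mem_box hb a hx, exchange_mem_box hb a hy, (exchange_injective b a).ne hxy,
        not_le.1 hescape⟩

theorem isSupersolution_survivalBound {ε t : ℝ} (hM : 1 ≤ M)
    (hMt : (M : ℝ) ^ 2 ≤ ε⁻¹ ^ 2 * t) :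
    IsSupersolution (bonds N) {PairState.dead}ᶜ (PairState.step M) ε (survivalStates N M) t
      (fun τ => survivalBound M (ε⁻¹ ^ 2 * t) (ε⁻¹ ^ 2 * (t - τ)))
      (fun _ i => match i with
        | .dead => 0
        | .escaped => 0
        | .live _ _ => -(ε⁻¹ ^ 2 / (ε⁻¹ ^ 2 * t))) := by
  have ht : 0 < ε⁻¹ ^ 2 * t := lt_of_lt_of_le (by positivity) hMt
  have hgap : ∀ {x y : ℤ}, |x - y| < (M : ℤ) →
      (0 : ℝ) ≤ (|x - y| : ℤ) ∧ ((|x - y| : ℤ) : ℝ) ≤ M := fun h =>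
    ⟨by exact_mod_cast abs_nonneg _, by exact_mod_cast h.le⟩
  have hpassed : ∀ τ ∈ Set.Icc 0 t, 0 ≤ ε⁻¹ ^ 2 * (t - τ) := fun τ hτ =>
    mul_nonneg (sq_nonneg _) (sub_nonneg.2 hτ.2)
  refine ⟨fun i hi b hb a => step_mem_survivalStates hi hb a, ?_, ?_, ?_, ?_⟩
  · rintro (_ | _ | ⟨x, y⟩) - τ
    · exact hasDerivAt_const _ _
    · exact hasDerivAt_const _ _
    · refine ((((((hasDerivAt_id τ).const_sub t).const_mul (ε⁻¹ ^ 2)).const_add _).div_const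
        _).const_add _).congr_deriv ?_
      ring
  · rintro (_ | _ | ⟨x, y⟩) hi τ hτ
    · exact le_rfl
    · exact zero_le_one
    · exact gapBound_nonneg ht.le (hpassed τ hτ) (hgap hi.2.2.2).1 (hgap hi.2.2.2).2
  · rintro (_ | _ | ⟨x, y⟩) hi hF
    · exact absurd rfl hF
    · exact le_rfl
    · simpa only [survivalBound, sub_zero] using
        one_le_gapBound_self ht (hgap hi.2.2.2).1 (hgap hi.2.2.2).2
  · rintro (_ | _ | ⟨x, y⟩) hi τ hτ
    · simp [PairState.step]
    · simp [PairState.step]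
    · obtain ⟨hx, hy, hxy, hd⟩ := hi
      rw [Finset.sum_congr rfl fun b _ => sum_survivalBound_step hd b]
      calc _ ≤ ε⁻¹ ^ 2 / 2 * -(2 / (ε⁻¹ ^ 2 * t)) := by
            gcongr
            exact cappedGapBound_generator hM hMt (hpassed τ hτ) hx hy hxy hd
        _ = -(ε⁻¹ ^ 2 / (ε⁻¹ ^ 2 * t)) := by ring

theorem marksLaw_le_tau_le {ε t : ℝ} (hN : 1 ≤ N) (hε : 0 < ε) (hM : 2 ≤ M)
    (hMt : (M : ℝ) ^ 2 ≤ ε⁻¹ ^ 2 * t) (hx : x ∈ box N) (hy : y ∈ box N) (hxy : |x - y| = 1) :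
    (marksLaw ε).real {ω | (t : EReal) ≤ tau N x y ω} ≤ 1 / M + M / (2 * (ε⁻¹ ^ 2 * t)) := by
  have hs : 0 < ε⁻¹ ^ 2 * t := lt_of_lt_of_le (by positivity) hMt
  have ht : 0 < t := pos_of_mul_pos_right hs (by positivity)
  have hstart : PairState.live x y ∈ survivalStates N M :=
    ⟨hx, hy, fun h => by simp [h] at hxy, by rw [hxy]; exact_mod_cast hM⟩
  have hbound := (isSupersolution_survivalBound (N := N) (by omega) hMt).marksLaw_real_le hε hstart
    (A := {ω | (t : EReal) ≤ tau N x y ω}) ⟨ht.le, le_rfl⟩ (by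
      filter_upwards [ae_regular hε (bonds N)] with ω hreg hω n
      exact hreg.mem_chainEvent_of_le_tau M hN n hx hy hω)
  simp only [survivalBound, gapBound, hxy, sub_self, mul_zero, add_zero, Int.cast_one,
    one_mul] at hbound
  calc _ ≤ 1 / (M : ℝ) + (M - 1) / 2 / (ε⁻¹ ^ 2 * t) := hbound
    _ ≤ 1 / M + M / 2 / (ε⁻¹ ^ 2 * t) := by gcongr; linarith
    _ = _ := by rw [div_div]

theorem exists_nat_first_mark_rate {q : ℝ} (hq : 2 ≤ q) :
    ∃ M : ℕ, 2 ≤ M ∧ (M : ℝ) ≤ q ∧ 1 / (M : ℝ) + M / (2 * q ^ 2) ≤ 4 / (q + 1) := by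
  have hM : 2 ≤ ⌊q⌋₊ := Nat.le_floor hq
  have hMq : (⌊q⌋₊ : ℝ) ≤ q := Nat.floor_le (by linarith)
  have hqM : q < ⌊q⌋₊ + 1 := Nat.lt_floor_add_one q
  refine ⟨⌊q⌋₊, hM, hMq, ?_⟩
  generalize ⌊q⌋₊ = M at *
  have hM0 : (2 : ℝ) ≤ M := by exact_mod_cast hM
  calc 1 / (M : ℝ) + M / (2 * q ^ 2) ≤ 3 / 2 / q + 1 / 2 / q := by
        gcongr ?_ + ?_
        · rw [div_le_div_iff₀ (by linarith) (by linarith)]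
          linarith
        · rw [div_le_div_iff₀ (by positivity) (by linarith)]
          nlinarith
    _ = 2 / q := by ring
    _ ≤ 4 / (q + 1) := by
        rw [div_le_div_iff₀ (by linarith) (by linarith)]
        linarith

theorem marksLaw_le_tau_le_div_sqrt {ε t : ℝ} (hε : 0 < ε) (hx : x ∈ box N) (hy : y ∈ box N)
    (hxy : |x - y| = 1) :
    (marksLaw ε).real {ω | (t : EReal) ≤ tau N x y ω} ≤ 4 / (√(ε⁻¹ ^ 2 * t) + 1) := by
  have := isProbabilityMeasure_marksLaw hε
  have hN : 1 ≤ N := by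
    rw [mem_box] at hx hy
    grind
  obtain ⟨q, hq⟩ : ∃ q, q = √(ε⁻¹ ^ 2 * t) := ⟨_, rfl⟩
  rw [← hq]
  rcases lt_or_ge q 2 with hq2 | hq2
  · have hq0 : 0 ≤ q := hq ▸ Real.sqrt_nonneg _
    refine measureReal_le_one.trans ?_
    rw [le_div_iff₀ (by linarith)]
    linarith
  have hqs : q ^ 2 = ε⁻¹ ^ 2 * t := by
    rw [hq, Real.sq_sqrt]
    exact (Real.sqrt_pos.1 (hq ▸ by linarith)).le
  obtain ⟨M, hM, hMq, hrate⟩ := exists_nat_first_mark_rate hq2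
  calc (marksLaw ε).real {ω | (t : EReal) ≤ tau N x y ω}
      ≤ 1 / M + M / (2 * q ^ 2) := by
        rw [hqs]
        exact marksLaw_le_tau_le hN hε hM (hqs ▸ by gcongr) hx hy hxy
    _ ≤ 4 / (q + 1) := hrate

end FirstMark

section NumberOfMarks

variable {N M : ℕ} {x y : ℤ}

/-- A truncated parabola that decreases from `1` to `0` on `[0, M]`. -/
def parabola (M : ℕ) (k : ℤ) : ℝ := max ((M : ℝ) - k) 0 ^ 2 / (M : ℝ) ^ 2

theorem parabola_nonneg (k : ℤ) : 0 ≤ parabola M k := by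
  unfold parabola
  positivity

theorem parabola_le_one {k : ℤ} (hk : 0 ≤ k) : parabola M k ≤ 1 := by
  have hk0 : (0 : ℝ) ≤ k := by exact_mod_cast hk
  exact div_le_one_of_le₀ (pow_le_pow_left₀ (le_max_right _ _)
    (max_le (by linarith) M.cast_nonneg) 2) (by positivity)

theorem parabola_eq_zero {k : ℤ} (hk : (M : ℤ) ≤ k) : parabola M k = 0 := by
  have hk0 : (M : ℝ) - k ≤ 0 := sub_nonpos.2 (by exact_mod_cast hk)
  rw [parabola, max_eq_right hk0, zero_pow two_ne_zero, zero_div]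

theorem parabola_second_difference (M : ℕ) (k : ℤ) :
    (parabola M (k + 1) - parabola M k) + (parabola M (k - 1) - parabola M k) ≤
      2 / (M : ℝ) ^ 2 := by
  unfold parabola
  rw [← sub_div, ← sub_div, ← add_div]
  refine div_le_div_of_nonneg_right ?_ (by positivity)
  push_cast
  rcases max_cases ((M : ℝ) - (k + 1)) 0 with ⟨hr, _⟩ | ⟨hr, _⟩ <;>
  rcases max_cases ((M : ℝ) - k) 0 with ⟨hc, _⟩ | ⟨hc, _⟩ <;>
  rcases max_cases ((M : ℝ) - (k - 1)) 0 with ⟨hl, _⟩ | ⟨hl, _⟩ <;>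
  rw [hr, hc, hl] <;> nlinarith

theorem parabola_sub_le (hM : 1 ≤ M) {k : ℤ} (hk : 0 ≤ k) :
    parabola M k - parabola M (k + 1) ≤ (2 * M - 1) / (M : ℝ) ^ 2 := by
  have hM0 : (1 : ℝ) ≤ M := by exact_mod_cast hM
  have hk0 : (0 : ℝ) ≤ k := by exact_mod_cast hk
  unfold parabola
  rw [← sub_div]
  refine div_le_div_of_nonneg_right ?_ (by positivity)
  push_cast
  rcases max_cases ((M : ℝ) - (k + 1)) 0 with ⟨hr, _⟩ | ⟨hr, _⟩ <;>
  rcases max_cases ((M : ℝ) - k) 0 with ⟨hc, _⟩ | ⟨hc, _⟩ <;>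
  rw [hr, hc] <;> nlinarith

theorem parabola_one_sub_zero (hM : 1 ≤ M) :
    parabola M 1 - parabola M 0 = -((2 * M - 1) / (M : ℝ) ^ 2) := by
  have hM0 : (1 : ℝ) ≤ M := by exact_mod_cast hM
  unfold parabola
  push_cast
  rw [max_eq_left (by linarith), max_eq_left (by linarith)]
  ring

theorem parabola_two_sub_one (hM : 1 ≤ M) :
    parabola M 2 - parabola M 1 ≤ -((2 * M - 3) / (M : ℝ) ^ 2) := by
  have hone := parabola_one_sub_zero hM
  have hsecond := parabola_second_difference M 1
  norm_num at hsecond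
  linarith [(by ring : (2 * M - 1 : ℝ) / (M : ℝ) ^ 2 = (2 * M - 3) / (M : ℝ) ^ 2 + 2 / (M : ℝ) ^ 2)]

theorem sum_bonds_parabola_left_le (hM : 1 ≤ M) (hMN : M ≤ N) (hx : x ∈ box N) :
    ∑ b ∈ bonds N, (parabola M (exchange b true x + N) - parabola M (x + N)) ≤
      2 / (M : ℝ) ^ 2 - if -(N : ℤ) < x then 0 else (2 * M - 1) / (M : ℝ) ^ 2 := by
  have hpos : 0 ≤ 2 / (M : ℝ) ^ 2 := by positivity
  rw [sum_bonds_exchange hx fun z => parabola M (z + N),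
    add_right_comm x 1, sub_add_eq_add_sub x 1]
  rw [mem_box] at hx
  rcases hx.1.eq_or_lt with rfl | hleft
  · rw [if_pos (by omega), neg_add_cancel, zero_add, parabola_one_sub_zero hM]
    simpa using hpos
  rcases hx.2.eq_or_lt with rfl | hright
  · rw [parabola_eq_zero (by omega : (M : ℤ) ≤ N + N - 1),
      parabola_eq_zero (by omega : (M : ℤ) ≤ (N : ℤ) + N)]
    simpa [hleft] using hpos
  · simpa only [hleft, hright, if_true, sub_zero] using parabola_second_difference M (x + N)

theorem sum_bonds_parabola_right_le (hM : 1 ≤ M) (hMN : M ≤ N) (hx : x ∈ box N) :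
    ∑ b ∈ bonds N, (parabola M (N - exchange b true x) - parabola M (N - x)) ≤
      2 / (M : ℝ) ^ 2 - if x < N then 0 else (2 * M - 1) / (M : ℝ) ^ 2 := by
  have hpos : 0 ≤ 2 / (M : ℝ) ^ 2 := by positivity
  rw [sum_bonds_exchange hx fun z => parabola M (N - z), ← sub_sub, ← sub_add]
  rw [mem_box] at hx
  rcases hx.2.eq_or_lt with rfl | hright
  · rw [if_neg (lt_irrefl _), if_pos (by omega), sub_self, zero_add, zero_add,
      parabola_one_sub_zero hM]
    simpa using hpos
  rcases hx.1.eq_or_lt with rfl | hleft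
  · rw [parabola_eq_zero (by omega : (M : ℤ) ≤ N - -N - 1),
      parabola_eq_zero (by omega : (M : ℤ) ≤ (N : ℤ) - -N)]
    simpa [hright] using hpos
  · rw [if_pos hright, if_pos hleft, if_pos hright, sub_zero, add_comm]
    exact parabola_second_difference M (N - x)

/-- The contribution of the walls to `pairWeight`. -/
def wallWeight (N M : ℕ) (x : ℤ) : ℝ := parabola M (x + N) + parabola M (N - x)

/-- A function of the positions of the two particles that is large when they are close to each
other or to the walls. The drop of `wallWeight` at a particle that leaves a wall makes up for the
move, blocked by the wall, that would have taken the particles further apart. -/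
def pairWeight (N M : ℕ) (x y : ℤ) : ℝ :=
  1 + parabola M |x - y| + (wallWeight N M x + wallWeight N M y)

theorem one_le_pairWeight (N M : ℕ) (x y : ℤ) : 1 ≤ pairWeight N M x y := by
  unfold pairWeight wallWeight
  linarith [parabola_nonneg (M := M) |x - y|, parabola_nonneg (M := M) (x + N),
    parabola_nonneg (M := M) (N - x), parabola_nonneg (M := M) (y + N),
    parabola_nonneg (M := M) (N - y)]

theorem pairWeight_le (M : ℕ) (hx : x ∈ box N) (hy : y ∈ box N) : pairWeight N M x y ≤ 6 := by
  rw [mem_box] at hx hy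
  unfold pairWeight wallWeight
  linarith [parabola_le_one (M := M) (abs_nonneg (x - y)),
    parabola_le_one (M := M) (by omega : 0 ≤ x + N),
    parabola_le_one (M := M) (by omega : 0 ≤ N - x),
    parabola_le_one (M := M) (by omega : 0 ≤ y + N),
    parabola_le_one (M := M) (by omega : 0 ≤ N - y)]

theorem pairWeight_comm (x y : ℤ) : pairWeight N M x y = pairWeight N M y x := by
  unfold pairWeight
  rw [abs_sub_comm, add_comm (wallWeight N M x)]

theorem sum_bonds_wallWeight_le (hM : 1 ≤ M) (hMN : M ≤ N) (hx : x ∈ box N) :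
    ∑ b ∈ bonds N, (wallWeight N M (exchange b true x) - wallWeight N M x) ≤
      4 / (M : ℝ) ^ 2 - (if -(N : ℤ) < x then 0 else (2 * M - 1) / (M : ℝ) ^ 2) -
        if x < N then 0 else (2 * M - 1) / (M : ℝ) ^ 2 := by
  simp only [wallWeight, add_sub_add_comm, Finset.sum_add_distrib]
  have hleft := sum_bonds_parabola_left_le hM hMN hx
  have hright := sum_bonds_parabola_right_le hM hMN hx
  linarith [(by ring : 4 / (M : ℝ) ^ 2 = 2 / (M : ℝ) ^ 2 + 2 / (M : ℝ) ^ 2)]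

theorem exchange_eq_or_swap_of_touch {b : ℤ} (h : Touch b x y) (a : Bool) :
    (exchange b a x = x ∧ exchange b a y = y) ∨ (exchange b a x = y ∧ exchange b a y = x) := by
  cases a
  · exact .inl ⟨exchange_false .., exchange_false ..⟩
  · right
    rcases h with ⟨rfl, rfl⟩ | ⟨rfl, rfl⟩ <;> simp [exchange_true]

theorem wallWeight_exchange_of_touch {b : ℤ} (h : Touch b x y) (a : Bool) :
    wallWeight N M (exchange b a x) + wallWeight N M (exchange b a y) =
      wallWeight N M x + wallWeight N M y := by
  obtain ⟨hx, hy⟩ | ⟨hx, hy⟩ := exchange_eq_or_swap_of_touch h a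
  · rw [hx, hy]
  · rw [hx, hy, add_comm]

theorem pairWeight_exchange_of_touch {b : ℤ} (h : Touch b x y) (a : Bool) :
    pairWeight N M (exchange b a x) (exchange b a y) = pairWeight N M x y := by
  obtain ⟨hx, hy⟩ | ⟨hx, hy⟩ := exchange_eq_or_swap_of_touch h a
  · rw [hx, hy]
  · rw [hx, hy, pairWeight_comm]

theorem sum_bonds_pairWeight (κ : ℝ) :
    ∑ b ∈ bonds N, (if Touch b x y then κ
        else pairWeight N M (exchange b true x) (exchange b true y) - pairWeight N M x y) =
      ∑ b ∈ bonds N, (if Touch b x y then κ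
        else parabola M |exchange b true x - exchange b true y| - parabola M |x - y|) +
      (∑ b ∈ bonds N, (wallWeight N M (exchange b true x) - wallWeight N M x) +
        ∑ b ∈ bonds N, (wallWeight N M (exchange b true y) - wallWeight N M y)) := by
  rw [← Finset.sum_add_distrib, ← Finset.sum_add_distrib]
  refine Finset.sum_congr rfl fun b _ => ?_
  split_ifs with htouch
  · linarith [wallWeight_exchange_of_touch (N := N) (M := M) htouch true]
  · unfold pairWeight
    ring

theorem parabola_gap_drift_le (hM : 1 ≤ M) {d : ℤ} {κ : ℝ} (hκ : κ ≤ 3 / M) :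
    (if d = 1 then κ else 2 * (parabola M (d - 1) - parabola M d)) +
      2 * (parabola M (d + 1) - parabola M d) ≤ 6 / (M : ℝ) ^ 2 := by
  have hM0 : (1 : ℝ) ≤ M := by exact_mod_cast hM
  split_ifs with hd
  · have hfarther := parabola_two_sub_one hM
    subst hd
    calc κ + 2 * (parabola M 2 - parabola M 1) ≤ 3 / M + 2 * -((2 * M - 3) / (M : ℝ) ^ 2) := by
          linarith
      _ = (6 - M) / (M : ℝ) ^ 2 := by field_simp; ring
      _ ≤ 6 / (M : ℝ) ^ 2 := by gcongr; linarith
  · calc _ = 2 * ((parabola M (d + 1) - parabola M d) + (parabola M (d - 1) - parabola M d)) := by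
          ring
      _ ≤ 2 * (2 / (M : ℝ) ^ 2) := by gcongr; exact parabola_second_difference M d
      _ = 4 / (M : ℝ) ^ 2 := by ring
      _ ≤ 6 / (M : ℝ) ^ 2 := by gcongr; norm_num

theorem pairWeight_generator_of_lt (hM : 1 ≤ M) (hMN : M ≤ N) (hx : x ∈ box N) (hy : y ∈ box N)
    (hxy : x < y) {κ : ℝ} (hκ : κ ≤ 3 / M) :
    ∑ b ∈ bonds N, (if Touch b x y then κ else
      pairWeight N M (exchange b true x) (exchange b true y) - pairWeight N M x y) ≤
      14 / (M : ℝ) ^ 2 := by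
  rw [sum_bonds_pairWeight, sum_bonds_gap hx hy hxy]
  have hwallx := sum_bonds_wallWeight_le hM hMN hx
  have hwally := sum_bonds_wallWeight_le hM hMN hy
  have hdrop := parabola_sub_le hM (sub_pos.2 hxy).le
  have hgap := parabola_gap_drift_le hM (d := y - x) hκ
  simp only [show y - x = 1 ↔ y = x + 1 by omega] at hgap
  have hxN : x < N := by rw [mem_box] at hy; omega
  have hyN : -(N : ℤ) < y := by rw [mem_box] at hx; omega
  rw [if_pos hxN] at hwallx
  rw [if_pos hyN] at hwally
  have hblocked : ((if -(N : ℤ) < x then 1 else 0) + (if y < N then 1 else 0)) *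
        (parabola M (y - x + 1) - parabola M (y - x)) ≤
      2 * (parabola M (y - x + 1) - parabola M (y - x)) +
        ((if -(N : ℤ) < x then 0 else (2 * M - 1) / (M : ℝ) ^ 2) +
          if y < N then 0 else (2 * M - 1) / (M : ℝ) ^ 2) := by
    split_ifs <;> linarith
  linarith [(by ring : 14 / (M : ℝ) ^ 2 = 6 / (M : ℝ) ^ 2 + 2 * (4 / (M : ℝ) ^ 2))]

theorem pairWeight_generator (hM : 1 ≤ M) (hMN : M ≤ N) (hx : x ∈ box N) (hy : y ∈ box N)
    (hxy : x ≠ y) {κ : ℝ} (hκ : κ ≤ 3 / M) :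
    ∑ b ∈ bonds N, (if Touch b x y then κ else
      pairWeight N M (exchange b true x) (exchange b true y) - pairWeight N M x y) ≤
      14 / (M : ℝ) ^ 2 := by
  wlog h : x < y generalizing x y
  · simpa only [touch_comm (x := y), pairWeight_comm y x,
      fun b => pairWeight_comm (N := N) (M := M) (exchange b true y) (exchange b true x)] using
      this hy hx hxy.symm (lt_of_le_of_ne (not_lt.1 h) hxy.symm)
  · exact pairWeight_generator_of_lt hM hMN hx hy h hκ

/-- The supersolution for the number of marks between the particles, with growth rate `κ`. -/
def countBound (N M : ℕ) (κ τ : ℝ) (i : ℕ × ℤ × ℤ) : ℝ :=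
  (1 + 1 / (4 * M : ℝ))⁻¹ ^ i.1 * pairWeight N M i.2.1 i.2.2 * Real.exp (κ * τ)

theorem inv_pow_pred_le {a : ℝ} (ha : 1 ≤ a) (j : ℕ) : a⁻¹ ^ (j - 1) ≤ a * a⁻¹ ^ j := by
  cases j with
  | zero => simpa using ha
  | succ j => rw [pow_succ', mul_inv_cancel_left₀ (by positivity), Nat.add_sub_cancel]

theorem sum_countBound_step_le (N M : ℕ) (κ τ : ℝ) (j : ℕ) (x y b : ℤ) :
    ∑ a : Bool, (countBound N M κ τ (countStep (j, x, y) b a) - countBound N M κ τ (j, x, y)) ≤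
      (1 + 1 / (4 * M : ℝ))⁻¹ ^ j * Real.exp (κ * τ) *
        if Touch b x y then 2 * (1 / (4 * M)) * pairWeight N M x y else
          pairWeight N M (exchange b true x) (exchange b true y) - pairWeight N M x y := by
  have hψ : 0 ≤ pairWeight N M x y := zero_le_one.trans (one_le_pairWeight N M x y)
  simp only [countBound, countStep, Fintype.sum_bool]
  split_ifs with htouch
  · rw [pairWeight_exchange_of_touch htouch, pairWeight_exchange_of_touch htouch]
    have hpred := mul_le_mul_of_nonneg_right
      (inv_pow_pred_le (a := 1 + 1 / (4 * M : ℝ)) (le_add_of_nonneg_right (by positivity)) j)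
      (mul_nonneg hψ (Real.exp_nonneg (κ * τ)))
    linarith
  · rw [exchange_false, exchange_false]
    exact le_of_eq (by ring)

theorem isSupersolution_countBound (hM : 1 ≤ M) (hMN : M ≤ N) (ε t : ℝ) :
    IsSupersolution (bonds N) {i | i.1 = 0} countStep ε
      {i | i.2.1 ∈ box N ∧ i.2.2 ∈ box N ∧ i.2.1 ≠ i.2.2} t
      (countBound N M (7 * ε⁻¹ ^ 2 / (M : ℝ) ^ 2))
      (fun τ i => 7 * ε⁻¹ ^ 2 / (M : ℝ) ^ 2 *
        countBound N M (7 * ε⁻¹ ^ 2 / (M : ℝ) ^ 2) τ i) := by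
  obtain ⟨κ, hκ⟩ : ∃ κ, κ = 7 * ε⁻¹ ^ 2 / (M : ℝ) ^ 2 := ⟨_, rfl⟩
  rw [← hκ]
  have hψ0 : ∀ x y, 0 ≤ pairWeight N M x y := fun x y =>
    zero_le_one.trans (one_le_pairWeight N M x y)
  refine ⟨?_, ?_, ?_, ?_, ?_⟩
  · rintro ⟨j, x, y⟩ ⟨hx, hy, hxy⟩ b hb a
    exact ⟨exchange_mem_box hb a hx, exchange_mem_box hb a hy, (exchange_injective b a).ne hxy⟩
  · rintro i - τ
    refine (((hasDerivAt_id τ).const_mul κ).exp.const_mul _).congr_deriv ?_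
    simp only [countBound, id]
    ring
  · rintro i - τ -
    exact mul_nonneg (mul_nonneg (by positivity) (hψ0 _ _)) (Real.exp_nonneg _)
  · rintro ⟨j, x, y⟩ - rfl
    simpa [countBound] using one_le_pairWeight N M x y
  · rintro ⟨j, x, y⟩ ⟨hx, hy, hxy⟩ τ -
    have hreward : 2 * (1 / (4 * M)) * pairWeight N M x y ≤ 3 / M :=
      calc 2 * (1 / (4 * M)) * pairWeight N M x y ≤ 2 * (1 / (4 * M)) * 6 := by
            gcongr
            exact pairWeight_le M hx hy
        _ = 3 / M := by ring
    calc _ ≤ ε⁻¹ ^ 2 / 2 * ∑ b ∈ bonds N, (1 + 1 / (4 * M : ℝ))⁻¹ ^ j * Real.exp (κ * τ) *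
          (if Touch b x y then 2 * (1 / (4 * M)) * pairWeight N M x y else
            pairWeight N M (exchange b true x) (exchange b true y) - pairWeight N M x y) := by
          gcongr with b
          exact sum_countBound_step_le N M κ τ j x y b
      _ ≤ ε⁻¹ ^ 2 / 2 * ((1 + 1 / (4 * M : ℝ))⁻¹ ^ j * Real.exp (κ * τ) *
          (14 / (M : ℝ) ^ 2 * pairWeight N M x y)) := by
          rw [← Finset.mul_sum]
          gcongr
          exact (pairWeight_generator hM hMN hx hy hxy hreward).trans
            (le_mul_of_one_le_right (by positivity) (one_le_pairWeight N M x y))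
      _ = κ * countBound N M κ τ (j, x, y) := by
          rw [countBound, hκ]
          ring

theorem marksLaw_le_numMarks_le {ε t : ℝ} (hε : 0 < ε) (ht : 0 ≤ t) (hM : 1 ≤ M) (hMN : M ≤ N)
    (hx : x ∈ box N) (hy : y ∈ box N) (hxy : x ≠ y) (j : ℕ) :
    (marksLaw ε).real {ω | (j : ℕ∞) ≤ numMarks N x y t ω} ≤
      6 * Real.exp (7 * (ε⁻¹ ^ 2 * t) / (M : ℝ) ^ 2) * (1 + 1 / (4 * M : ℝ))⁻¹ ^ j := by
  have hbound := (isSupersolution_countBound hM hMN ε t).marksLaw_real_le hε (i := (j, x, y))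
    (A := {ω | (j : ℕ∞) ≤ numMarks N x y t ω}) ⟨hx, hy, hxy⟩ ⟨ht, le_rfl⟩ (by
      filter_upwards [ae_regular hε (bonds N)] with ω hreg hω n
      exact hreg.mem_chainEvent_of_le_numMarks (hM.trans hMN) n hx hy hω)
  calc _ ≤ (1 + 1 / (4 * M : ℝ))⁻¹ ^ j * pairWeight N M x y *
        Real.exp (7 * ε⁻¹ ^ 2 / (M : ℝ) ^ 2 * t) := hbound
    _ ≤ (1 + 1 / (4 * M : ℝ))⁻¹ ^ j * 6 * Real.exp (7 * ε⁻¹ ^ 2 / (M : ℝ) ^ 2 * t) := by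
        gcongr
        exact pairWeight_le M hx hy
    _ = _ := by
        rw [div_mul_eq_mul_div, mul_assoc 7]
        ring

theorem numMarks_self (N : ℕ) (x : ℤ) (t : ℝ) (ω : Marks) : numMarks N x x t ω = 0 := by
  simp [numMarks, contactMarks, contactTimes]

theorem natCeil_le_of_ofReal_le {a : ℝ} {n : ℕ∞} (h : ENNReal.ofReal a ≤ (n : ℝ≥0∞)) :
    ((⌈a⌉₊ : ℕ) : ℕ∞) ≤ n := by
  induction n with
  | top => exact le_top
  | coe m =>
    rw [ENat.toENNReal_coe, ENNReal.ofReal_le_natCast] at h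
    exact_mod_cast Nat.ceil_le.2 h

end NumberOfMarks

section StretchedExponential

variable {N : ℕ} {ε t T ζ k : ℝ} {x y : ℤ}

theorem inv_one_add_pow_le_exp {m : ℝ} (hm : 1 ≤ m) (j : ℕ) :
    (1 + 1 / (4 * m))⁻¹ ^ j ≤ Real.exp (-(j / (5 * m))) := by
  have hbase : (1 + 1 / (4 * m))⁻¹ ≤ Real.exp (-(1 / (5 * m))) := by
    refine le_trans ?_ (Real.add_one_le_exp _)
    rw [inv_le_iff_one_le_mul₀ (by positivity)]
    have hprod : (-(1 / (5 * m)) + 1) * (1 + 1 / (4 * m)) = 1 + (m - 1) / (20 * m ^ 2) := by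
      field_simp
      ring
    rw [hprod]
    exact le_add_of_nonneg_right (div_nonneg (sub_nonneg.2 hm) (by positivity))
  calc (1 + 1 / (4 * m))⁻¹ ^ j ≤ Real.exp (-(1 / (5 * m))) ^ j := by gcongr
    _ = Real.exp (-(j / (5 * m))) := by
      rw [← Real.exp_nat_mul]
      congr 1
      ring

theorem exp_neg_rpow_le {a : ℝ} (ha : 0 < a) (hζ : 0 < ζ) (k : ℝ) :
    ∃ C : ℝ, 0 ≤ C ∧ ∀ n : ℝ, 1 ≤ n → Real.exp (-(n ^ ζ / a)) ≤ C * n ^ (-k) := by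
  obtain ⟨p, hp⟩ := exists_nat_ge (k / ζ)
  refine ⟨p.factorial * a ^ p, by positivity, fun n hn => ?_⟩
  have hn0 : 0 < n := by linarith
  have htaylor := Real.pow_div_factorial_le_exp (n ^ ζ / a) (by positivity) p
  rw [div_pow, div_div, div_le_iff₀ (by positivity)] at htaylor
  have hpow : n ^ k ≤ (n ^ ζ) ^ p := by
    rw [← Real.rpow_natCast, ← Real.rpow_mul hn0.le]
    refine Real.rpow_le_rpow_of_exponent_le hn ?_
    rwa [div_le_iff₀' hζ] at hp
  rw [Real.exp_neg, Real.rpow_neg hn0.le, ← div_eq_mul_inv, le_div_iff₀ (by positivity),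
    inv_mul_le_iff₀ (Real.exp_pos _)]
  linarith

theorem rpow_div_le_natCeil_div {a n : ℝ} (hn : 0 < n) (ζ : ℝ) (ha : 0 ≤ a) :
    n ^ ζ / a ≤ ⌈n ^ (1 / 2 + ζ)⌉₊ / (a * √n) := by
  have hsqrt : n ^ ζ * √n ≤ ⌈n ^ (1 / 2 + ζ)⌉₊ := by
    rw [mul_comm, Real.sqrt_eq_rpow, ← Real.rpow_add hn]
    exact Nat.le_ceil _
  rw [div_mul_eq_div_div_swap]
  exact div_le_div_of_nonneg_right ((le_div_iff₀ (by positivity)).2 hsqrt) ha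

theorem exists_scale {n : ℝ} (hT : 0 < T) (hn : 1 ≤ n) (hnT : n ≤ T * N ^ 2) :
    ∃ M : ℕ, 1 ≤ M ∧ M ≤ N ∧ n / T ≤ (M : ℝ) ^ 2 ∧ (M : ℝ) ≤ (1 / √T + 1) * √n := by
  have hn0 : 0 < n := by linarith
  refine ⟨⌈√(n / T)⌉₊, Nat.one_le_ceil_iff.2 (by positivity), ?_, ?_, ?_⟩
  · refine Nat.ceil_le.2 (Real.sqrt_le_iff.2 ⟨N.cast_nonneg, ?_⟩)
    rwa [div_le_iff₀' hT]
  · exact Real.sqrt_le_iff.1 (Nat.le_ceil _) |>.2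
  · calc (⌈√(n / T)⌉₊ : ℝ) ≤ √(n / T) + 1 := (Nat.ceil_lt_add_one (Real.sqrt_nonneg _)).le
      _ ≤ √(n / T) + √n := by gcongr; exact Real.one_le_sqrt.2 hn
      _ = (1 / √T + 1) * √n := by rw [Real.sqrt_div hn0.le]; ring

theorem marksLaw_le_numMarks_le_exp (hε : 0 < ε) (ht : 0 ≤ t) (hT : 0 < T)
    (hn : 1 ≤ ε⁻¹ ^ 2 * t) (hnT : ε⁻¹ ^ 2 * t ≤ T * N ^ 2) (hx : x ∈ box N) (hy : y ∈ box N)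
    (hxy : x ≠ y) (j : ℕ) :
    (marksLaw ε).real {ω | (j : ℕ∞) ≤ numMarks N x y t ω} ≤
      6 * Real.exp (7 * T) * Real.exp (-(j / (5 * (1 / √T + 1) * √(ε⁻¹ ^ 2 * t)))) := by
  obtain ⟨M, hM, hMN, hlower, hupper⟩ := exists_scale hT hn hnT
  have hM0 : (1 : ℝ) ≤ M := by exact_mod_cast hM
  have hgrowth : 7 * (ε⁻¹ ^ 2 * t) / (M : ℝ) ^ 2 ≤ 7 * T := by
    rw [div_le_iff₀' hT] at hlower
    rw [div_le_iff₀ (by positivity)]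
    linarith
  calc _ ≤ 6 * Real.exp (7 * (ε⁻¹ ^ 2 * t) / (M : ℝ) ^ 2) * (1 + 1 / (4 * M : ℝ))⁻¹ ^ j :=
        marksLaw_le_numMarks_le hε ht hM hMN hx hy hxy j
    _ ≤ 6 * Real.exp (7 * T) * Real.exp (-(j / (5 * M))) := by
        gcongr
        exact inv_one_add_pow_le_exp hM0 j
    _ ≤ _ := by
        rw [mul_assoc 5]
        gcongr

theorem marksLaw_rpow_le_numMarks_le (hT : 0 < T) (hζ : 0 < ζ) (hk : 0 ≤ k) :
    ∃ c : ℝ, ∀ (N : ℕ) (ε t : ℝ), 0 < ε → 0 < t → ε⁻¹ ^ 2 * t ≤ T * N ^ 2 →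
      ∀ x ∈ box N, ∀ y ∈ box N,
        (marksLaw ε).real {ω | ENNReal.ofReal ((ε⁻¹ ^ 2 * t) ^ (1 / 2 + ζ)) ≤
          (numMarks N x y t ω : ℝ≥0∞)} ≤ c * (ε⁻¹ ^ 2 * t) ^ (-k) := by
  obtain ⟨C, hC0, hC⟩ :=
    exp_neg_rpow_le (a := 5 * (1 / √T + 1)) (by positivity) hζ k
  refine ⟨1 + 6 * Real.exp (7 * T) * C, fun N ε t hε ht hnT x hx y hy => ?_⟩
  have := isProbabilityMeasure_marksLaw hε
  have hn0 : 0 < ε⁻¹ ^ 2 * t := by positivity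
  have hscale := fun hn hxy => marksLaw_le_numMarks_le_exp hε ht.le hT hn hnT hx hy hxy
  generalize ε⁻¹ ^ 2 * t = n at *
  have hnk : 0 ≤ n ^ (-k) := by positivity
  rcases lt_or_ge n 1 with hn1 | hn1
  · calc _ ≤ (1 : ℝ) := measureReal_le_one
      _ ≤ n ^ (-k) := Real.one_le_rpow_of_pos_of_le_one_of_nonpos hn0 hn1.le (neg_nonpos.2 hk)
      _ ≤ _ := le_mul_of_one_le_left hnk (le_add_of_nonneg_right (by positivity))
  rcases eq_or_ne x y with rfl | hxy
  · have hempty : {ω | ENNReal.ofReal (n ^ (1 / 2 + ζ)) ≤ (numMarks N x x t ω : ℝ≥0∞)} = ∅ := by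
      ext ω
      have : 0 < n ^ (1 / 2 + ζ) := by positivity
      simpa [numMarks_self] using this
    rw [hempty, measureReal_empty]
    positivity
  have hrate := rpow_div_le_natCeil_div hn0 ζ (a := 5 * (1 / √T + 1)) (by positivity)
  calc _ ≤ (marksLaw ε).real {ω | (⌈n ^ (1 / 2 + ζ)⌉₊ : ℕ∞) ≤ numMarks N x y t ω} :=
        measureReal_mono fun ω hω => natCeil_le_of_ofReal_le hω
    _ ≤ _ := hscale hn1 hxy _
    _ ≤ 6 * Real.exp (7 * T) * Real.exp (-(n ^ ζ / (5 * (1 / √T + 1)))) := by gcongr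
    _ ≤ 6 * Real.exp (7 * T) * (C * n ^ (-k)) := by
        gcongr
        exact hC n hn1
    _ ≤ (1 + 6 * Real.exp (7 * T) * C) * n ^ (-k) := by linarith

end StretchedExponential

end Stirring

end

theorem theorem4p4_general :
    (∃ c : ℝ, ∀ (N : ℕ) (ε t : ℝ), 0 < ε → 0 ≤ t →
      ∀ x₁ ∈ Stirring.box N, ∀ x₂ ∈ Stirring.box N, |x₁ - x₂| = 1 →
        (Stirring.marksLaw ε).real {ω | (t : EReal) ≤ Stirring.tau N x₁ x₂ ω} ≤
          c / (√(ε⁻¹ ^ 2 * t) + 1)) ∧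
    (∀ T : ℝ, 0 < T → ∀ ζ : ℝ, 0 < ζ → ∀ k : ℝ, 0 ≤ k →
      ∃ c : ℝ, ∀ (N : ℕ) (ε t : ℝ), 0 < ε → 0 < t → ε⁻¹ ^ 2 * t ≤ T * N ^ 2 →
        ∀ x₁ ∈ Stirring.box N, ∀ x₂ ∈ Stirring.box N,
          (Stirring.marksLaw ε).real
              {ω | ENNReal.ofReal ((ε⁻¹ ^ 2 * t) ^ (1 / 2 + ζ)) ≤
                (Stirring.numMarks N x₁ x₂ t ω : ENNReal)} ≤
            c * (ε⁻¹ ^ 2 * t) ^ (-k)) :=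
  ⟨⟨4, fun _ _ _ hε _ _ hx _ hy hxy => Stirring.marksLaw_le_tau_le_div_sqrt hε hx hy hxy⟩,
    fun _ hT _ hζ _ hk => Stirring.marksLaw_rpow_le_numMarks_le hT hζ hk⟩

theorem theorem4p4 :
    (∃ c : ℝ, ∀ (N : ℕ) (ε : ℝ), 1 ≤ N → ε = 1 / (N : ℝ) →
      ∀ t : ℝ, 0 ≤ t → ∀ x₁ ∈ Stirring.box N, ∀ x₂ ∈ Stirring.box N, |x₁ - x₂| = 1 →
        (Stirring.marksLaw ε).real {ω | (t : EReal) ≤ Stirring.tau N x₁ x₂ ω} ≤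
          c / ((ε⁻¹ ^ 2 * t) ^ (1 / 2 : ℝ) + 1)) ∧
    (∀ T : ℝ, 0 < T → ∀ ζ : ℝ, 0 < ζ → ∀ k : ℝ, 1 ≤ k →
      ∃ c : ℝ, ∀ t : ℝ, 0 < t → t ≤ T →
        ∀ (N : ℕ) (ε : ℝ), 1 ≤ N → ε = 1 / (N : ℝ) →
          ∀ x₁ ∈ Stirring.box N, ∀ x₂ ∈ Stirring.box N,
            (Stirring.marksLaw ε).real
                {ω | ENNReal.ofReal ((ε⁻¹ ^ 2 * t) ^ (1 / 2 + ζ)) ≤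
                  (Stirring.numMarks N x₁ x₂ t ω : ENNReal)} ≤
              c * (ε⁻¹ ^ 2 * t) ^ (-k)) := by
  obtain ⟨⟨c, hτ⟩, hnum⟩ := theorem4p4_general
  refine ⟨⟨c, fun N ε hN hε t ht x hx y hy hxy => ?_⟩, fun T hT ζ hζ k hk => ?_⟩
  · rw [← Real.sqrt_eq_rpow]
    exact hτ N ε t (by rw [hε]; positivity) ht x hx y hy hxy
  · obtain ⟨c, hc⟩ := hnum T hT ζ hζ k (by linarith)
    refine ⟨c, fun t ht htT N ε hN hε => hc N ε t (by rw [hε]; positivity) ht ?_⟩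
    rw [hε, one_div, inv_inv, mul_comm]
    gcongr
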